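/- Let $n\in\mathbb N$, $T>0$, let $H_0,H_1\in\mathfrak{su}(n)$ be traceless skew-Hermitian matrices and let $\rho_0,\theta$ be Hermitian $n\times n$ matrices with simple eigenvalues. Put $\mathcal H=L^2([0,T],\mathbb R)$ with its standard inner product, and for $u\in\mathcal H$ let $\mathrm{End}_{\rho_0}(u)=\rho(T)$, where $\rho$ is the (Carathéodory) solution of $\dot\rho(t)=[H_0+u(t)H_1,\rho(t)]$, $\rho(0)=\rho_0$. Let $\mathcal O(\rho_0)=\{U\rho_0U^\dagger: U\in SU(n)\}$, with tangent spaces $T_\rho\mathcal O(\rho_0)=\{[\rho,\Omega]:\Omega\in\mathfrak{su}(n)\}$ and dimension $N$; let $J(\rho)=\operatorname{Re}\operatorname{tr}(\rho\theta)$ on $\mathcal O(\rho_0)$ and $\mathcal J=J\circ\mathrm{End}_{\rho_0}$ on $\mathcal H$. Assume that every control is regular: for all $u\in\mathcal H$ the rank of $d\,\mathrm{End}_{\rho_0}(u)$ equals $N$. Let $\rho_i$ be a critical point of $J$ on $\mathcal O(\rho_0)$ and $\mathcal H_i=\{u\in\mathcal H:\mathrm{End}_{\rho_0}(u)=\rho_i\}$.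 Then there is an integer $0\le N_1^i\le N$, depending on $\rho_i$ only, such that for every connected component $\mathcal C$ of $\mathcal H_i$ and every $u_c\in\mathcal C$ the following holds. The Morse index of $\mathcal J$ at $u_c$ (the maximal dimension of a subspace of $\mathcal H$ on which the second derivative of $\mathcal J$ at $u_c$ is negative definite) is $N_1^i$, and there are an orthogonal decomposition $\mathcal H=\mathcal P_1\oplus\mathcal P_2\oplus\mathcal K$, an open neighbourhood $U$ of $u_c$ in $\mathcal H$ and a smooth chart $\phi$, i.e. a smooth diffeomorphism from $U$ onto an open subset $\phi(U)$ of $\mathcal H=\mathcal P_1\oplus\mathcal P_2\oplus\mathcal K$, such that (i) $\dim\mathcal P_1=N_1^i$ and $\dim\mathcal P_2=N-N_1^i$; (ii) $\phi(u_c)=0$ and $\phi(U\cap\mathcal C)=\{(v_1,v_2,w)\in\mathcal P_1\times\mathcal P_2\times\mathcal K:\ v_1=v_2=0\}$; (iii) $\mathcal J\circ\phi^{-1}(v_1,v_2,w)=\mathcal J(u_c)-\|v_1\|_{\mathcal H}^2+\|v_2\|_{\mathcal H}^2$ for all $(v_1,v_2,w)\in\phi(U)$. -/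

import Mathlib

open MeasureTheory
open scoped Matrix ContDiff

namespace QuantumControl

noncomputable section

/-- The space `L²([0,T], ℝ)` of admissible controls, with its standard inner product. -/
abbrev Control (T : ℝ) : Type := Lp ℝ 2 ((volume : Measure ℝ).restrict (Set.Icc 0 T))

/-- The real vector space of traceless skew-Hermitian `n × n` matrices. -/
def su (n : ℕ) : Submodule ℝ (Matrix (Fin n) (Fin n) ℂ) where
  carrier := {A | Aᴴ = -A ∧ A.trace = 0}
  add_mem' := by
    rintro A B ⟨hA, hA'⟩ ⟨hB, hB'⟩
    refine ⟨?_, ?_⟩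
    · rw [Matrix.conjTranspose_add, hA, hB, neg_add]
    · rw [Matrix.trace_add, hA', hB', add_zero]
  zero_mem' := by simp
  smul_mem' := by
    rintro c A ⟨hA, hA'⟩
    refine ⟨?_, ?_⟩
    · rw [Matrix.conjTranspose_smul, hA, star_trivial, smul_neg]
    · rw [Matrix.trace_smul, hA', smul_zero]

/-- The unitary orbit `{U ρ₀ U† : U ∈ SU(n)}` of a matrix `ρ₀`. -/
def orbit {n : ℕ} (ρ₀ : Matrix (Fin n) (Fin n) ℂ) : Set (Matrix (Fin n) (Fin n) ℂ) :=
  {ρ | ∃ U ∈ Matrix.specialUnitaryGroup (Fin n) ℂ, ρ = U * ρ₀ * Uᴴ}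

/-- The real-linear map `Ω ↦ [ρ, Ω] = ρ Ω - Ω ρ`. -/
def adMap {n : ℕ} (ρ : Matrix (Fin n) (Fin n) ℂ) :
    Matrix (Fin n) (Fin n) ℂ →ₗ[ℝ] Matrix (Fin n) (Fin n) ℂ where
  toFun Ω := ρ * Ω - Ω * ρ
  map_add' A B := by rw [mul_add, add_mul]; abel
  map_smul' c A := by simp [smul_sub]

/-- The tangent space `[ρ, 𝔰𝔲(n)]` at `ρ` of the unitary orbit through `ρ`. -/
def tangentSpace {n : ℕ} (ρ : Matrix (Fin n) (Fin n) ℂ) :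
    Submodule ℝ (Matrix (Fin n) (Fin n) ℂ) :=
  (su n).map (adMap ρ)

/-- The dimension `N` of the unitary orbit of `ρ₀`. -/
def orbitDim {n : ℕ} (ρ₀ : Matrix (Fin n) (Fin n) ℂ) : ℕ :=
  Module.finrank ℝ (tangentSpace ρ₀)

/-- The kinematic cost `J(ρ) = Re tr (ρ θ)`. -/
def kinematicCost {n : ℕ} (θ ρ : Matrix (Fin n) (Fin n) ℂ) : ℝ :=
  ((ρ * θ).trace).re

/-- `ρ` is a critical point of the restriction of `J` to the unitary orbit of `ρ₀`: it lies on the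
orbit and the differential of `J` at `ρ` vanishes on the tangent space of the orbit at `ρ`. -/
def IsKinematicCritical {n : ℕ} (θ ρ₀ ρ : Matrix (Fin n) (Fin n) ℂ) : Prop :=
  ρ ∈ orbit ρ₀ ∧ ∀ η ∈ tangentSpace ρ, fderiv ℝ (kinematicCost θ) ρ η = 0

/-- `ρ` is the trajectory on `[0,T]` (a Carathéodory solution, in integrated form, entry by entry)
of `ρ' = [H₀ + u(t) H₁, ρ]`, `ρ(0) = ρ₀`. -/
def IsTrajectory {n : ℕ} (T : ℝ) (H₀ H₁ ρ₀ : Matrix (Fin n) (Fin n) ℂ) (u : Control T)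
    (ρ : ℝ → Matrix (Fin n) (Fin n) ℂ) : Prop :=
  ContinuousOn ρ (Set.Icc 0 T) ∧
    ∀ t ∈ Set.Icc 0 T, ∀ j k : Fin n,
      ρ t j k = ρ₀ j k +
        ∫ s in (0 : ℝ)..t, ((H₀ + u s • H₁) * ρ s - ρ s * (H₀ + u s • H₁)) j k

/-- The end-point map `u ↦ ρ(T)`, where `ρ` is the (unique) trajectory driven by `u`. -/
def endPoint {n : ℕ} (T : ℝ) (H₀ H₁ ρ₀ : Matrix (Fin n) (Fin n) ℂ) (u : Control T) :
    Matrix (Fin n) (Fin n) ℂ :=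
  Classical.epsilon fun σ => ∃ ρ, IsTrajectory T H₀ H₁ ρ₀ u ρ ∧ ρ T = σ

/-- The cost `𝒥(u) = Re tr (End(u) θ)` on the space of controls. -/
def cost {n : ℕ} (T : ℝ) (H₀ H₁ ρ₀ θ : Matrix (Fin n) (Fin n) ℂ) (u : Control T) : ℝ :=
  ((endPoint T H₀ H₁ ρ₀ u * θ).trace).re

/-- `u` is a regular control: the rank of the differential of the end-point map at `u` is the
dimension of the unitary orbit. -/
def IsRegularControl {n : ℕ} (T : ℝ) (H₀ H₁ ρ₀ : Matrix (Fin n) (Fin n) ℂ)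
    (u : Control T) : Prop :=
  Module.finrank ℝ (LinearMap.range (fderiv ℝ (endPoint T H₀ H₁ ρ₀) u).toLinearMap) = orbitDim ρ₀

/-- The set of controls that steer `ρ₀` to `σ` in time `T`. -/
def fiber {n : ℕ} (T : ℝ) (H₀ H₁ ρ₀ σ : Matrix (Fin n) (Fin n) ℂ) : Set (Control T) :=
  {u | endPoint T H₀ H₁ ρ₀ u = σ}

/-- The Morse index of `f` at `x`: the supremum of the dimensions of the finite-dimensional
subspaces on which the second derivative of `f` at `x` is negative definite. -/
def morseIndex {E : Type*} [NormedAddCommGroup E] [NormedSpace ℝ E] (f : E → ℝ) (x : E) : ℕ∞ :=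
  ⨆ (W : Submodule ℝ E) (_ : FiniteDimensional ℝ W)
    (_ : ∀ v ∈ W, v ≠ 0 → fderiv ℝ (fderiv ℝ f) x v v < 0), (Module.finrank ℝ W : ℕ∞)

end

end QuantumControl

/-! The end point is `U(u) ρ₀ U(u)†` with `U(u)` a unitary propagator, so its variations are
commutators. Over a critical point `ρ` one has `[θ, ρ] = 0`. There the first variation of the end
point is `[A, ρ]` with `A` skew-Hermitian, and the second variation of the cost is `Re tr ([A, [A,
ρ]] θ)`; the remaining acceleration term is a bracket `[B, ρ]` with `B` skew, which the cost
annihilates (`exists_second_variation`). Because matrices with simple spectrum have commutative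
commutants, this form depends on `A` only through `[A, ρ]` and is nondegenerate on the tangent space
of the orbit (`exists_signature`). The Hessian of the cost is thus the pullback, under the
surjective differential of the end-point map, of a form attached to `ρ` alone; its negative index is
the Morse index at every control over `ρ`.

For the normal form, constant rank makes the end point, hence the cost, depend locally on only `N`
coordinates (`constant_rank_eq`). The infinite-dimensional directions drop out exactly, and
`morse_lemma` applies to the reduced function (`morse_bott_chart`).

Smoothness of the end-point map comes from writing a trajectory as `(1 - V_u)⁻¹` applied to a
constant, with `V_u` affine in `u` and of Volterra type, so that `1 - V_u` is always invertible. -/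

namespace QuantumControl

noncomputable section

/-! ### Linear controlled equations as Volterra integral equations -/

section Volterra

set_option linter.unusedSectionVars false

variable {W : Type*} [NormedAddCommGroup W] [NormedSpace ℝ W] [CompleteSpace W] {T : ℝ}

lemma Control.integrableOn (u : Control T) : IntegrableOn u (Set.Icc 0 T) :=
  (Lp.memLp u).integrable one_le_two

lemma integrableOn_control_smul (h : 0 ≤ T) (u : Control T) (M : W →L[ℝ] W)
    (x : C(Set.Icc (0 : ℝ) T, W)) :
    IntegrableOn (fun s => u s • M (Set.IccExtend h x s)) (Set.Icc 0 T) :=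
  u.integrableOn.smul_continuousOn
    (M.continuous.comp x.continuous.Icc_extend').continuousOn isCompact_Icc

lemma intervalIntegrable_control_smul (h : 0 ≤ T) (u : Control T) (M : W →L[ℝ] W)
    (x : C(Set.Icc (0 : ℝ) T, W)) {t : ℝ} (ht : t ∈ Set.Icc 0 T) :
    IntervalIntegrable (fun s => u s • M (Set.IccExtend h x s)) volume 0 t := by
  rw [intervalIntegrable_iff_integrableOn_Icc_of_le ht.1]
  exact (integrableOn_control_smul h u M x).mono_set (Set.Icc_subset_Icc_right ht.2)

/-- The Volterra operator `x ↦ (t ↦ ∫₀ᵗ u(s) M x(s) ds)`. -/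
def volterraFun (h : 0 ≤ T) (M : W →L[ℝ] W) (u : Control T) (x : C(Set.Icc (0 : ℝ) T, W)) :
    C(Set.Icc (0 : ℝ) T, W) where
  toFun t := ∫ s in (0 : ℝ)..t, u s • M (Set.IccExtend h x s)
  continuous_toFun := by
    have := intervalIntegral.continuousOn_primitive_interval (a := 0) (b := T)
      (f := fun s => u s • M (Set.IccExtend h x s)) (μ := volume) (by
        rw [Set.uIcc_of_le h]; exact integrableOn_control_smul h u M x)
    rw [Set.uIcc_of_le h, continuousOn_iff_continuous_domRestrict] at this
    exact this

lemma volterraFun_apply (h : 0 ≤ T) (M : W →L[ℝ] W) (u : Control T)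
    (x : C(Set.Icc (0 : ℝ) T, W)) (t : Set.Icc (0 : ℝ) T) :
    volterraFun h M u x t = ∫ s in (0 : ℝ)..t, u s • M (Set.IccExtend h x s) := rfl

lemma integral_control_sq_le (u : Control T) {t : ℝ} (ht : t ∈ Set.Icc 0 T) :
    ∫ s in (0 : ℝ)..t, (u s) ^ 2 ≤ ‖u‖ ^ 2 := by
  have h1 : ‖u‖ ^ 2 = ∫ s in Set.Icc 0 T, (u s) ^ 2 := by
    rw [← real_inner_self_eq_norm_sq, L2.inner_def]
    simp [sq]
  have hI : IntegrableOn (fun s => (u s) ^ 2) (Set.Icc 0 T) := (Lp.memLp u).integrable_sq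
  rw [h1, intervalIntegral.integral_of_le ht.1, ← integral_Icc_eq_integral_Ioc]
  exact setIntegral_mono_set hI (Filter.Eventually.of_forall fun s => sq_nonneg _)
    (Set.Icc_subset_Icc_right ht.2).eventuallyLE

lemma sq_integral_mul_le {μ : Measure ℝ} {a b : ℝ → ℝ} (ha : MemLp a 2 μ) (hb : MemLp b 2 μ)
    (ha0 : 0 ≤ a) (hb0 : 0 ≤ b) :
    (∫ s, a s * b s ∂μ) ^ 2 ≤ (∫ s, a s ^ 2 ∂μ) * ∫ s, b s ^ 2 ∂μ := by
  have h := integral_mul_le_Lp_mul_Lq_of_nonneg (μ := μ) Real.HolderConjugate.two_two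
    (Filter.Eventually.of_forall ha0) (Filter.Eventually.of_forall hb0)
    (by simpa using ha) (by simpa using hb)
  have hA : 0 ≤ ∫ s, a s ^ 2 ∂μ := integral_nonneg fun s => sq_nonneg _
  have hB : 0 ≤ ∫ s, b s ^ 2 ∂μ := integral_nonneg fun s => sq_nonneg _
  have h0 : 0 ≤ ∫ s, a s * b s ∂μ := integral_nonneg fun s => mul_nonneg (ha0 s) (hb0 s)
  simp only [Real.rpow_two, ← Real.sqrt_eq_rpow] at h
  calc _ ≤ (√(∫ s, a s ^ 2 ∂μ) * √(∫ s, b s ^ 2 ∂μ)) ^ 2 := by gcongr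
    _ = _ := by rw [mul_pow, Real.sq_sqrt hA, Real.sq_sqrt hB]

/-- Cauchy–Schwarz, kept in squared form with the integral over `[0, t]` only: iterating a bound of
this shape produces factorials, which beat any size of `u`. -/
lemma norm_volterraFun_sq_le (h : 0 ≤ T) (M : W →L[ℝ] W) (u : Control T)
    (x : C(Set.Icc (0 : ℝ) T, W)) (t : Set.Icc (0 : ℝ) T) :
    ‖volterraFun h M u x t‖ ^ 2 ≤
      (‖M‖ * ‖u‖) ^ 2 * ∫ s in (0 : ℝ)..t, ‖Set.IccExtend h x s‖ ^ 2 := by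
  obtain ⟨t, ht⟩ := t
  have hc : Continuous fun s => ‖Set.IccExtend h x s‖ := x.continuous.Icc_extend'.norm
  have hu : MemLp (fun s => ‖u s‖) 2 ((volume : Measure ℝ).restrict (Set.Ioc 0 t)) :=
    (Lp.memLp u).norm.mono_measure
      (Measure.restrict_mono (Set.Ioc_subset_Icc_self.trans (Set.Icc_subset_Icc_right ht.2)) le_rfl)
  have hx : MemLp (fun s => ‖Set.IccExtend h x s‖) 2
      ((volume : Measure ℝ).restrict (Set.Ioc 0 t)) := by
    refine MemLp.of_bound hc.aestronglyMeasurable ‖x‖ (Filter.Eventually.of_forall fun s => ?_)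
    rw [norm_norm]
    exact x.norm_coe_le_norm _
  have h1 : ‖volterraFun h M u x ⟨t, ht⟩‖ ≤
      ‖M‖ * ∫ s in (0 : ℝ)..t, ‖u s‖ * ‖Set.IccExtend h x s‖ := by
    rw [← intervalIntegral.integral_const_mul]
    refine intervalIntegral.norm_integral_le_of_norm_le ht.1 (Filter.Eventually.of_forall ?_) ?_
    · intro s _
      rw [norm_smul, mul_left_comm]
      gcongr
      exact M.le_opNorm _
    · rw [intervalIntegrable_iff_integrableOn_Ioc_of_le ht.1]
      exact (hu.integrable_mul hx).const_mul _
  have h2 := sq_integral_mul_le hu hx (fun _ => norm_nonneg _) (fun _ => norm_nonneg _)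
  have h3 := integral_control_sq_le u ht
  simp only [intervalIntegral.integral_of_le ht.1, Real.norm_eq_abs, sq_abs] at *
  have h4 : 0 ≤ ∫ s in Set.Ioc 0 t, ‖Set.IccExtend h x s‖ ^ 2 :=
    integral_nonneg fun s => sq_nonneg _
  calc _ ≤ (‖M‖ * ∫ s in Set.Ioc 0 t, |u s| * ‖Set.IccExtend h x s‖) ^ 2 := by gcongr
    _ ≤ ‖M‖ ^ 2 * ((∫ s in Set.Ioc 0 t, u s ^ 2) *
          ∫ s in Set.Ioc 0 t, ‖Set.IccExtend h x s‖ ^ 2) := by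
        rw [mul_pow]; gcongr
    _ ≤ ‖M‖ ^ 2 * (‖u‖ ^ 2 * ∫ s in Set.Ioc 0 t, ‖Set.IccExtend h x s‖ ^ 2) := by gcongr
    _ = _ := by ring

lemma norm_volterraFun_le (h : 0 ≤ T) (M : W →L[ℝ] W) (u : Control T)
    (x : C(Set.Icc (0 : ℝ) T, W)) :
    ‖volterraFun h M u x‖ ≤ ‖M‖ * √T * ‖u‖ * ‖x‖ := by
  rw [ContinuousMap.norm_le _ (by positivity)]
  intro t
  refine abs_le_of_sq_le_sq' ?_ (by positivity) |>.2
  refine (norm_volterraFun_sq_le h M u x t).trans ?_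
  have : ∫ s in (0 : ℝ)..t, ‖Set.IccExtend h x s‖ ^ 2 ≤ T * ‖x‖ ^ 2 := by
    have h1 : ∫ s in (0 : ℝ)..t, ‖Set.IccExtend h x s‖ ^ 2 ≤ ∫ s in (0 : ℝ)..t, ‖x‖ ^ 2 := by
      refine intervalIntegral.integral_mono_on t.2.1 ?_ (by simp) fun s _ => ?_
      · exact (x.continuous.Icc_extend'.norm.pow 2).intervalIntegrable _ _
      · gcongr
        exact x.norm_coe_le_norm _
    refine h1.trans ?_
    simp only [intervalIntegral.integral_const, sub_zero, smul_eq_mul]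
    gcongr
    exact t.2.2
  calc _ ≤ (‖M‖ * ‖u‖) ^ 2 * (T * ‖x‖ ^ 2) := by gcongr
    _ = _ := by
      simp only [mul_pow, Real.sq_sqrt h]
      ring

/-- The Volterra operator, as a bounded linear operator that depends linearly on the control. -/
def volterra (h : 0 ≤ T) (M : W →L[ℝ] W) :
    Control T →L[ℝ] C(Set.Icc (0 : ℝ) T, W) →L[ℝ] C(Set.Icc (0 : ℝ) T, W) :=
  LinearMap.mkContinuous₂
    (LinearMap.mk₂ ℝ (volterraFun h M)
      (by
        intro u v x
        ext ⟨t, ht⟩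
        have h1 := intervalIntegrable_control_smul h u M x ht
        have h2 := intervalIntegrable_control_smul h v M x ht
        simp only [volterraFun_apply, ContinuousMap.add_apply]
        rw [← intervalIntegral.integral_add h1 h2]
        refine intervalIntegral.integral_congr_ae ?_
        have := (ae_restrict_iff' measurableSet_Icc).1 (Lp.coeFn_add u v)
        filter_upwards [this] with s hs hst
        rw [Set.uIoc_of_le ht.1] at hst
        rw [hs ⟨hst.1.le, hst.2.trans ht.2⟩, Pi.add_apply, add_smul])
      (by
        intro c u x
        ext ⟨t, ht⟩
        simp only [volterraFun_apply, ContinuousMap.smul_apply]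
        rw [← intervalIntegral.integral_smul]
        refine intervalIntegral.integral_congr_ae ?_
        have := (ae_restrict_iff' measurableSet_Icc).1 (Lp.coeFn_smul c u)
        filter_upwards [this] with s hs hst
        rw [Set.uIoc_of_le ht.1] at hst
        rw [hs ⟨hst.1.le, hst.2.trans ht.2⟩, Pi.smul_apply, smul_assoc])
      (by
        intro u x y
        ext ⟨t, ht⟩
        have h1 := intervalIntegrable_control_smul h u M x ht
        have h2 := intervalIntegrable_control_smul h u M y ht
        simp only [volterraFun_apply, ContinuousMap.add_apply]
        rw [← intervalIntegral.integral_add h1 h2]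
        congr 1
        ext s
        simp [Set.IccExtend_apply])
      (by
        intro c u x
        ext ⟨t, ht⟩
        simp only [volterraFun_apply, ContinuousMap.smul_apply]
        rw [← intervalIntegral.integral_smul]
        congr 1
        ext s
        simp only [Set.IccExtend_apply, ContinuousMap.smul_apply, map_smul]
        exact smul_comm _ _ _))
    (‖M‖ * √T) (norm_volterraFun_le h M)

lemma volterra_apply (h : 0 ≤ T) (M : W →L[ℝ] W) (u : Control T)
    (x : C(Set.Icc (0 : ℝ) T, W)) (t : Set.Icc (0 : ℝ) T) :
    volterra h M u x t = ∫ s in (0 : ℝ)..t, u s • M (Set.IccExtend h x s) := rfl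

/-- A Volterra-type bound makes `1 - V` invertible. -/
lemma isUnit_one_sub_of_volterra_bound (h : 0 ≤ T)
    (V : C(Set.Icc (0 : ℝ) T, W) →L[ℝ] C(Set.Icc (0 : ℝ) T, W)) (c : ℝ) (hc : 0 ≤ c)
    (hV : ∀ x t, ‖V x t‖ ^ 2 ≤ c * ∫ s in (0 : ℝ)..t, ‖Set.IccExtend h x s‖ ^ 2) :
    IsUnit (1 - V) := by
  -- Each application of `V` integrates the previous bound, proportional to `s ^ n`, and so
  -- contributes the next factor of the factorial.
  have hpow : ∀ (n : ℕ) (x : C(Set.Icc (0 : ℝ) T, W)) (t : Set.Icc (0 : ℝ) T),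
      ‖(V ^ n) x t‖ ^ 2 ≤ (c * t) ^ n / n.factorial * ‖x‖ ^ 2 := by
    intro n x
    induction n with
    | zero =>
      intro t
      simp only [pow_zero, Nat.factorial_zero, Nat.cast_one, div_one, one_mul]
      gcongr
      exact x.norm_coe_le_norm _
    | succ n ih =>
      intro t
      rw [pow_succ' V n]
      refine (hV ((V ^ n) x) t).trans ?_
      have h1 : ∫ s in (0 : ℝ)..t, ‖Set.IccExtend h ((V ^ n) x) s‖ ^ 2 ≤
          ∫ s in (0 : ℝ)..t, (c ^ n / n.factorial * ‖x‖ ^ 2) * s ^ n := by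
        refine intervalIntegral.integral_mono_on t.2.1 ?_ ?_ fun s hs => ?_
        · exact (((V ^ n) x).continuous.Icc_extend'.norm.pow 2).intervalIntegrable _ _
        · exact (by fun_prop : Continuous _).intervalIntegrable _ _
        · have hs' : s ∈ Set.Icc 0 T := ⟨hs.1, hs.2.trans t.2.2⟩
          rw [Set.IccExtend_of_mem h _ hs']
          refine (ih ⟨s, hs'⟩).trans (le_of_eq ?_)
          ring
      rw [intervalIntegral.integral_const_mul, integral_pow] at h1
      calc _ ≤ c * ((c ^ n / n.factorial * ‖x‖ ^ 2) *
            (((t : ℝ) ^ (n + 1) - 0 ^ (n + 1)) / (n + 1))) := by gcongr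
        _ = _ := by
          rw [Nat.factorial_succ]
          push_cast
          field_simp
          ring
  have hnorm : ∀ n : ℕ, ‖V ^ n‖ ≤ √((c * T) ^ n / n.factorial) := by
    intro n
    refine ContinuousLinearMap.opNorm_le_bound _ (by positivity) fun x => ?_
    rw [ContinuousMap.norm_le _ (by positivity)]
    intro t
    refine abs_le_of_sq_le_sq' ?_ (by positivity) |>.2
    rw [mul_pow, Real.sq_sqrt (by positivity)]
    refine (hpow n x t).trans ?_
    have := t.2.1
    have := t.2.2
    gcongr
  have hlim : Filter.Tendsto (fun n : ℕ => √((c * T) ^ n / n.factorial)) Filter.atTop (nhds 0) := by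
    have := (FloorSemiring.tendsto_pow_div_factorial_atTop (c * T)).sqrt
    simpa using this
  -- Some power has norm below `1`, so `1 - V ^ n` is a unit. It is the product of `1 - V` with a
  -- geometric sum commuting with it, so `1 - V` is a unit too.
  obtain ⟨n, hn⟩ := (hlim.eventually (gt_mem_nhds one_pos)).exists
  have hu : IsUnit (1 - V ^ n) := isUnit_one_sub_of_norm_lt_one
    (R := C(Set.Icc (0 : ℝ) T, W) →L[ℝ] C(Set.Icc (0 : ℝ) T, W)) ((hnorm n).trans_lt hn)
  rw [← mul_neg_geom_sum V n] at hu
  refine ((Commute.isUnit_mul_iff ?_).1 hu).1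
  exact (Commute.sum_right _ _ _ fun i _ => Commute.sub_left (Commute.one_left _) ((Commute.refl V).pow_right i))

/-- The constant control `1`. -/
def unitControl (T : ℝ) : Control T :=
  Lp.const 2 ((volume : Measure ℝ).restrict (Set.Icc 0 T)) (1 : ℝ)

lemma unitControl_ae (T : ℝ) : ∀ᵐ s ∂volume, s ∈ Set.Icc 0 T → unitControl T s = 1 :=
  (ae_restrict_iff' measurableSet_Icc).1 (Lp.coeFn_const _ _ _)

/-- The integral operator of the linear equation `x' = (M₀ + u M₁) x`. -/
def picard (h : 0 ≤ T) (M₀ M₁ : W →L[ℝ] W) (u : Control T) :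
    C(Set.Icc (0 : ℝ) T, W) →L[ℝ] C(Set.Icc (0 : ℝ) T, W) :=
  volterra h M₀ (unitControl T) + volterra h M₁ u

/-- The drift is treated as a control term driven by the constant `1`, a value taken only almost
everywhere, which the integral does not see. -/
lemma picard_apply (h : 0 ≤ T) (M₀ M₁ : W →L[ℝ] W) (u : Control T)
    (x : C(Set.Icc (0 : ℝ) T, W)) (t : Set.Icc (0 : ℝ) T) :
    picard h M₀ M₁ u x t = ∫ s in (0 : ℝ)..t,
      (M₀ (Set.IccExtend h x s) + u s • M₁ (Set.IccExtend h x s)) := by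
  obtain ⟨t, ht⟩ := t
  simp only [picard, add_apply, ContinuousMap.add_apply, volterra_apply]
  rw [← intervalIntegral.integral_add (intervalIntegrable_control_smul h _ _ x ht)
    (intervalIntegrable_control_smul h _ _ x ht)]
  refine intervalIntegral.integral_congr_ae ?_
  filter_upwards [unitControl_ae T] with s hs hst
  rw [Set.uIoc_of_le ht.1] at hst
  rw [hs ⟨hst.1.le, hst.2.trans ht.2⟩, one_smul]

lemma isUnit_one_sub_picard (h : 0 ≤ T) (M₀ M₁ : W →L[ℝ] W) (u : Control T) :
    IsUnit (1 - picard h M₀ M₁ u) := by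
  -- The factor `2` comes from `(a + b)² ≤ 2 (a² + b²)`, applied to the drift and control parts.
  refine isUnit_one_sub_of_volterra_bound h _
    (2 * ((‖M₀‖ * ‖unitControl T‖) ^ 2 + (‖M₁‖ * ‖u‖) ^ 2)) (by positivity) fun x t => ?_
  have h1 := norm_volterraFun_sq_le h M₀ (unitControl T) x t
  have h2 := norm_volterraFun_sq_le h M₁ u x t
  have h3 : ‖picard h M₀ M₁ u x t‖ ≤
      ‖volterraFun h M₀ (unitControl T) x t‖ + ‖volterraFun h M₁ u x t‖ := norm_add_le _ _
  calc _ ≤ (‖volterraFun h M₀ (unitControl T) x t‖ + ‖volterraFun h M₁ u x t‖) ^ 2 := by gcongr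
    _ ≤ 2 * (‖volterraFun h M₀ (unitControl T) x t‖ ^ 2 + ‖volterraFun h M₁ u x t‖ ^ 2) :=
        add_sq_le
    _ ≤ _ := by linarith

/-- The solution of `x' = (M₀ + u M₁) x`, `x(0) = x₀` on `[0,T]`. -/
def linearFlow (h : 0 ≤ T) (M₀ M₁ : W →L[ℝ] W) (x₀ : W) (u : Control T) :
    C(Set.Icc (0 : ℝ) T, W) :=
  Ring.inverse (1 - picard h M₀ M₁ u) (ContinuousMap.const _ x₀)

/-- The operator `1 - picard` is affine and bounded in the control, and inversion is smooth at
units. -/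
lemma contDiff_linearFlow (h : 0 ≤ T) (M₀ M₁ : W →L[ℝ] W) (x₀ : W) :
    ContDiff ℝ ∞ (linearFlow h M₀ M₁ x₀) := by
  rw [contDiff_iff_contDiffAt]
  intro u
  obtain ⟨U, hU⟩ := isUnit_one_sub_picard h M₀ M₁ u
  have h1 : ContDiff ℝ ∞ (fun u : Control T => 1 - picard h M₀ M₁ u) :=
    by unfold picard; fun_prop
  have h2 : ContDiffAt ℝ ∞ (fun u : Control T => Ring.inverse (1 - picard h M₀ M₁ u)) u := by
    refine ContDiffAt.comp (g := Ring.inverse) u ?_ h1.contDiffAt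
    rw [← hU]
    exact contDiffAt_ringInverse ℝ
      (R := C(Set.Icc (0 : ℝ) T, W) →L[ℝ] C(Set.Icc (0 : ℝ) T, W)) U
  exact h2.clm_apply contDiffAt_const

/-- Existence and uniqueness at once, both being invertibility of `1 - picard`. -/
lemma linearFlow_eq_iff (h : 0 ≤ T) (M₀ M₁ : W →L[ℝ] W) (x₀ : W) (u : Control T)
    (x : C(Set.Icc (0 : ℝ) T, W)) :
    x = linearFlow h M₀ M₁ x₀ u ↔ ∀ t : Set.Icc (0 : ℝ) T, x t = x₀ + ∫ s in (0 : ℝ)..t,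
      (M₀ (Set.IccExtend h x s) + u s • M₁ (Set.IccExtend h x s)) := by
  have hU := isUnit_one_sub_picard h M₀ M₁ u
  have key : x = linearFlow h M₀ M₁ x₀ u ↔
      (1 - picard h M₀ M₁ u) x = ContinuousMap.const _ x₀ := by
    constructor
    · rintro rfl
      have := Ring.mul_inverse_cancel _ hU
      exact congrArg (fun V => V (ContinuousMap.const _ x₀)) this
    · intro hx
      have := Ring.inverse_mul_cancel _ hU
      rw [linearFlow, ← hx]
      exact (congrArg (fun V => V x) this).symm
  rw [key, ContinuousMap.ext_iff]
  refine forall_congr' fun t => ?_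
  rw [← picard_apply h M₀ M₁ u x t]
  simp [sub_eq_iff_eq_add]

lemma linearFlow_apply (h : 0 ≤ T) (M₀ M₁ : W →L[ℝ] W) (x₀ : W) (u : Control T)
    (t : Set.Icc (0 : ℝ) T) :
    linearFlow h M₀ M₁ x₀ u t = x₀ + ∫ s in (0 : ℝ)..t,
      (M₀ (Set.IccExtend h (linearFlow h M₀ M₁ x₀ u) s) +
        u s • M₁ (Set.IccExtend h (linearFlow h M₀ M₁ x₀ u) s)) :=
  (linearFlow_eq_iff h M₀ M₁ x₀ u _).1 rfl t

end Volterra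

/-! ### The commutator flow as conjugation by the propagator -/

section FlowAlgebra

set_option linter.unusedSectionVars false

variable {𝔸 : Type*} [NormedRing 𝔸] [NormedAlgebra ℝ 𝔸] {T : ℝ}

/-- The commutator `X ↦ A X - X A`, as a bounded operator. -/
def commCLM (A : 𝔸) : 𝔸 →L[ℝ] 𝔸 :=
  ContinuousLinearMap.mul ℝ 𝔸 A - (ContinuousLinearMap.mul ℝ 𝔸).flip A

@[simp] lemma commCLM_apply (A X : 𝔸) : commCLM A X = A * X - X * A := rfl

lemma commCLM_add_smul (A B X : 𝔸) (c : ℝ) :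
    commCLM A X + c • commCLM B X = (A + c • B) * X - X * (A + c • B) := by
  simp only [commCLM_apply, add_mul, mul_add, smul_sub, smul_mul_assoc, mul_smul_comm]
  abel

lemma hasDerivAt_conj [StarRing 𝔸] [StarModule ℝ 𝔸] [ContinuousStar 𝔸]
    {y : ℝ → 𝔸} {g : 𝔸} {t : ℝ} (hy : HasDerivAt y g t) (ρ : 𝔸) :
    HasDerivAt (fun t => y t * ρ * star (y t)) (g * ρ * star (y t) + y t * ρ * star g) t :=
  (hy.mul_const ρ).mul hy.star

variable [CompleteSpace 𝔸]

/-- The value at time `T` of the solution of `ρ' = [H₀ + u H₁, ρ]`, `ρ(0) = ρ₀`. -/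
def commFlow (h : 0 ≤ T) (H₀ H₁ ρ₀ : 𝔸) (u : Control T) : 𝔸 :=
  linearFlow h (commCLM H₀) (commCLM H₁) ρ₀ u ⟨T, h, le_rfl⟩

/-- The value at time `T` of the solution of `U' = (H₀ + u H₁) U`, `U(0) = 1`. -/
def propagator (h : 0 ≤ T) (H₀ H₁ : 𝔸) (u : Control T) : 𝔸 :=
  linearFlow h (ContinuousLinearMap.mul ℝ 𝔸 H₀) (ContinuousLinearMap.mul ℝ 𝔸 H₁) 1 u
    ⟨T, h, le_rfl⟩

lemma contDiff_linearFlow_apply {W : Type*} [NormedAddCommGroup W] [NormedSpace ℝ W]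
    [CompleteSpace W] (h : 0 ≤ T) (M₀ M₁ : W →L[ℝ] W) (x₀ : W) (t : Set.Icc (0 : ℝ) T) :
    ContDiff ℝ ∞ fun u => linearFlow h M₀ M₁ x₀ u t :=
  (ContinuousMap.evalCLM ℝ t : C(Set.Icc (0 : ℝ) T, W) →L[ℝ] W).contDiff.comp
    (contDiff_linearFlow h M₀ M₁ x₀)

lemma contDiff_commFlow (h : 0 ≤ T) (H₀ H₁ ρ₀ : 𝔸) : ContDiff ℝ ∞ (commFlow h H₀ H₁ ρ₀) :=
  contDiff_linearFlow_apply h _ _ _ _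

lemma contDiff_propagator (h : 0 ≤ T) (H₀ H₁ : 𝔸) : ContDiff ℝ ∞ (propagator h H₀ H₁) :=
  contDiff_linearFlow_apply h _ _ _ _

/-- A curve solves the commutator equation, tested against a separating family of functionals, if
and only if it is the linear flow. -/
lemma commutator_solution_iff (h : 0 ≤ T) (H₀ H₁ ρ₀ : 𝔸) (u : Control T) {ι : Type*}
    (e : ι → 𝔸 →L[ℝ] ℂ) (he : ∀ A B : 𝔸, (∀ i, e i A = e i B) → A = B)
    (x : C(Set.Icc (0 : ℝ) T, 𝔸)) (ρ : ℝ → 𝔸) (hρ : ∀ t : Set.Icc (0 : ℝ) T, ρ t = x t) :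
    (∀ t ∈ Set.Icc 0 T, ∀ i, e i (ρ t) = e i ρ₀ +
      ∫ s in (0 : ℝ)..t, e i ((H₀ + u s • H₁) * ρ s - ρ s * (H₀ + u s • H₁))) ↔
    x = linearFlow h (commCLM H₀) (commCLM H₁) ρ₀ u := by
  rw [linearFlow_eq_iff, Subtype.forall]
  refine forall₂_congr fun t ht => ?_
  have hi : IntervalIntegrable (fun s => commCLM H₀ (Set.IccExtend h x s) +
      u s • commCLM H₁ (Set.IccExtend h x s)) volume 0 t := by
    rw [intervalIntegrable_iff_integrableOn_Icc_of_le ht.1]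
    refine IntegrableOn.mono_set (t := Set.Icc 0 T) ?_ (Set.Icc_subset_Icc_right ht.2)
    exact ((commCLM H₀).continuous.comp x.continuous.Icc_extend').continuousOn.integrableOn_Icc.add
      (integrableOn_control_smul h u (commCLM H₁) x)
  have key : ∀ i, ∫ s in (0 : ℝ)..t, e i ((H₀ + u s • H₁) * ρ s - ρ s * (H₀ + u s • H₁)) =
      e i (∫ s in (0 : ℝ)..t, (commCLM H₀ (Set.IccExtend h x s) +
        u s • commCLM H₁ (Set.IccExtend h x s))) := by
    intro i
    rw [← ContinuousLinearMap.intervalIntegral_comp_comm (e i) hi]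
    refine intervalIntegral.integral_congr fun s hs => ?_
    rw [Set.uIcc_of_le ht.1] at hs
    have hs' : s ∈ Set.Icc 0 T := ⟨hs.1, hs.2.trans ht.2⟩
    simp only [commCLM_add_smul]
    rw [Set.IccExtend_of_mem h _ hs', ← hρ ⟨s, hs'⟩]
  simp only [key, ← map_add, ← hρ]
  exact ⟨fun H => he _ _ H, fun H i => by rw [H]⟩

lemma commFlow_one (h : 0 ≤ T) (H₀ H₁ : 𝔸) (u : Control T) :
    commFlow h H₀ H₁ 1 u = 1 := by
  rw [commFlow, ← (linearFlow_eq_iff h _ _ _ _ (ContinuousMap.const _ 1)).2]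
  · rfl
  · intro t
    simp [Set.IccExtend_apply]

variable [StarRing 𝔸] [StarModule ℝ 𝔸] [ContinuousStar 𝔸]

/-- With a continuous representative of the control the propagator is classically differentiable;
Leibniz' rule and skewness of the generators show that `U ρ₀ U†` solves the commutator equation, and
uniqueness concludes. -/
lemma linearFlow_conj_of_continuous (h : 0 ≤ T) {H₀ H₁ : 𝔸}
    (hH₀ : star H₀ = -H₀) (hH₁ : star H₁ = -H₁) (ρ₀ : 𝔸) (u : Control T)
    (f : ℝ → ℝ) (hf : Continuous f) (hfu : ∀ᵐ s ∂volume, s ∈ Set.Icc 0 T → u s = f s)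
    (t : Set.Icc (0 : ℝ) T) :
    linearFlow h (commCLM H₀) (commCLM H₁) ρ₀ u t =
      linearFlow h (ContinuousLinearMap.mul ℝ 𝔸 H₀) (ContinuousLinearMap.mul ℝ 𝔸 H₁) 1 u t * ρ₀ *
        star (linearFlow h (ContinuousLinearMap.mul ℝ 𝔸 H₀)
          (ContinuousLinearMap.mul ℝ 𝔸 H₁) 1 u t) := by
  set x := linearFlow h (ContinuousLinearMap.mul ℝ 𝔸 H₀) (ContinuousLinearMap.mul ℝ 𝔸 H₁) 1 u
    with hx
  set xe := Set.IccExtend h x with hxe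
  have hxc : Continuous xe := x.continuous.Icc_extend'
  set g : ℝ → 𝔸 := fun s => H₀ * xe s + f s • (H₁ * xe s) with hg
  have hgc : Continuous g := by fun_prop
  -- `y` extends the propagator trajectory to a curve differentiable on all of `ℝ`, which avoids
  -- one-sided derivatives at `0` and `T`.
  set y : ℝ → 𝔸 := fun t => 1 + ∫ s in (0 : ℝ)..t, g s with hy
  have hyd : ∀ t, HasDerivAt y (g t) t := fun t =>
    (hgc.integral_hasStrictDerivAt 0 t).hasDerivAt.const_add 1
  have hyx : ∀ t : Set.Icc (0 : ℝ) T, y t = x t := by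
    intro t
    rw [hx, linearFlow_apply, hy]
    refine congrArg _ (intervalIntegral.integral_congr_ae ?_)
    filter_upwards [hfu] with s hs hst
    rw [Set.uIoc_of_le t.2.1] at hst
    rw [hs ⟨hst.1.le, hst.2.trans t.2.2⟩]
    rfl
  have hyxe : ∀ s ∈ Set.Icc 0 T, xe s = y s := fun s hs => by
    rw [hxe, Set.IccExtend_of_mem h _ hs, ← hyx ⟨s, hs⟩]
  set P : ℝ → 𝔸 := fun t => y t * ρ₀ * star (y t) with hP
  have hPd : ∀ t, HasDerivAt P (g t * ρ₀ * star (y t) + y t * ρ₀ * star (g t)) t :=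
    fun t => hasDerivAt_conj (hyd t) ρ₀
  have hPc : Continuous P := continuous_iff_continuousAt.2 fun t => (hPd t).continuousAt
  have hyc : Continuous y := continuous_iff_continuousAt.2 fun t => (hyd t).continuousAt
  have hP0 : P 0 = ρ₀ := by simp [hP, hy]
  let z : C(Set.Icc (0 : ℝ) T, 𝔸) := ⟨fun t => P t, hPc.comp continuous_subtype_val⟩
  have hz : z = linearFlow h (commCLM H₀) (commCLM H₁) ρ₀ u := by
    rw [linearFlow_eq_iff]
    intro t
    have hi := intervalIntegral.integral_eq_sub_of_hasDerivAt (a := 0) (b := (t : ℝ))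
      (fun s _ => hPd s) ((by fun_prop : Continuous fun s =>
        g s * ρ₀ * star (y s) + y s * ρ₀ * star (g s)).intervalIntegrable _ _)
    rw [hP0] at hi
    change P t = _
    rw [← sub_eq_iff_eq_add', ← hi]
    refine intervalIntegral.integral_congr_ae ?_
    filter_upwards [hfu] with s hs hst
    rw [Set.uIoc_of_le t.2.1] at hst
    have hs' : s ∈ Set.Icc 0 T := ⟨hst.1.le, hst.2.trans t.2.2⟩
    rw [hs hs', commCLM_add_smul, Set.IccExtend_of_mem h _ hs']
    change _ = (H₀ + f s • H₁) * P s - P s * (H₀ + f s • H₁)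
    have hgs : g s = (H₀ + f s • H₁) * y s := by
      rw [hg]
      simp only [hyxe s hs', add_mul, smul_mul_assoc]
    have hA : star (H₀ + f s • H₁) = -(H₀ + f s • H₁) := by
      rw [star_add, star_smul, hH₀, hH₁, star_trivial, smul_neg, neg_add]
    rw [hgs, star_mul, hA]
    simp only [hP]
    noncomm_ring
  rw [← hz, ← hyx]
  rfl

/-- Both sides are continuous in the control, and bounded continuous functions are dense in `L²`. -/
lemma commFlow_eq_conj (h : 0 ≤ T) {H₀ H₁ : 𝔸} (hH₀ : star H₀ = -H₀) (hH₁ : star H₁ = -H₁)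
    (ρ₀ : 𝔸) (u : Control T) :
    commFlow h H₀ H₁ ρ₀ u = propagator h H₀ H₁ u * ρ₀ * star (propagator h H₀ H₁ u) := by
  have hd := Lp.boundedContinuousFunction_dense ℝ ((volume : Measure ℝ).restrict (Set.Icc 0 T))
    (p := 2) (by simp)
  have hp := (contDiff_propagator h H₀ H₁).continuous
  refine congrFun (Continuous.ext_on hd (contDiff_commFlow h H₀ H₁ ρ₀).continuous
    (g := fun u => propagator h H₀ H₁ u * ρ₀ * star (propagator h H₀ H₁ u)) (by fun_prop) ?_) u
  intro u hu
  obtain ⟨f, hf⟩ := Lp.mem_boundedContinuousFunction_iff.1 hu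
  have hfu : ∀ᵐ s ∂volume, s ∈ Set.Icc 0 T → u s = f s := by
    rw [← ae_restrict_iff' measurableSet_Icc]
    have h1 := ContinuousMap.coeFn_toAEEqFun ((volume : Measure ℝ).restrict (Set.Icc 0 T))
      f.toContinuousMap
    rw [hf] at h1
    exact h1
  exact linearFlow_conj_of_continuous h hH₀ hH₁ ρ₀ u f f.continuous hfu _

/-- Unitarity is the conjugation formula for the initial value `1`, whose commutator flow is
constant. -/
lemma propagator_mul_star (h : 0 ≤ T) {H₀ H₁ : 𝔸} (hH₀ : star H₀ = -H₀) (hH₁ : star H₁ = -H₁)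
    (u : Control T) : propagator h H₀ H₁ u * star (propagator h H₀ H₁ u) = 1 := by
  simpa [commFlow_one h] using (commFlow_eq_conj h hH₀ hH₁ 1 u).symm

end FlowAlgebra

/-! ### The end-point map is the commutator flow -/

section EndPoint

attribute [local instance] Matrix.linftyOpNormedRing Matrix.linftyOpNormedAlgebra

variable {n : ℕ} {T : ℝ}

/-- The entry functionals on matrices. -/
def entryCLM (i : Fin n × Fin n) : Matrix (Fin n) (Fin n) ℂ →L[ℝ] ℂ :=
  (Matrix.entryLinearMap ℝ ℂ i.1 i.2).toContinuousLinearMap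

/-- `Classical.epsilon` has content only once a trajectory exists; uniqueness on `[0, T]` then
forces the chosen value. -/
lemma endPoint_eq_commFlow (h : 0 ≤ T) (H₀ H₁ ρ₀ : Matrix (Fin n) (Fin n) ℂ) :
    endPoint T H₀ H₁ ρ₀ = commFlow h H₀ H₁ ρ₀ := by
  funext u
  have he : ∀ A B : Matrix (Fin n) (Fin n) ℂ, (∀ i, entryCLM i A = entryCLM i B) → A = B :=
    fun A B H => Matrix.ext fun j k => H (j, k)
  have hex : ∃ σ, ∃ ρ, IsTrajectory T H₀ H₁ ρ₀ u ρ ∧ ρ T = σ := by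
    let x := linearFlow h (commCLM H₀) (commCLM H₁) ρ₀ u
    refine ⟨_, Set.IccExtend h x, ⟨x.continuous.Icc_extend'.continuousOn, fun t ht j k => ?_⟩, rfl⟩
    exact (commutator_solution_iff h H₀ H₁ ρ₀ u entryCLM he x _
      fun t => Set.IccExtend_val h _ t).2 rfl t ht (j, k)
  obtain ⟨ρ, hρ, hT⟩ := Classical.epsilon_spec hex
  change _ = endPoint T H₀ H₁ ρ₀ u at hT
  have := (commutator_solution_iff h H₀ H₁ ρ₀ u entryCLM he
    ⟨fun t => ρ t, continuousOn_iff_continuous_domRestrict.1 hρ.1⟩ ρ fun t => rfl).1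
    fun t ht i => hρ.2 t ht i.1 i.2
  rw [commFlow, ← this, ← hT]
  rfl

end EndPoint

/-! ### Variations along a unitary orbit -/

section SecondVariation

variable {𝔸 : Type*} [NormedRing 𝔸] [NormedAlgebra ℝ 𝔸] [StarRing 𝔸] [StarModule ℝ 𝔸]
  [ContinuousStar 𝔸] {H : Type*} [NormedAddCommGroup H] [NormedSpace ℝ H]

lemma hasDerivAt_fderiv_line {H F : Type*} [NormedAddCommGroup H] [NormedSpace ℝ H]
    [NormedAddCommGroup F] [NormedSpace ℝ F] {c : H → F} (hc : ContDiff ℝ ∞ c) (u v : H) :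
    HasDerivAt (fun s : ℝ => fderiv ℝ c (u + s • v) v) (fderiv ℝ (fderiv ℝ c) u v v) 0 := by
  have hd : Differentiable ℝ (fderiv ℝ c) :=
    (hc.fderiv_right (m := ∞) (by simp)).differentiable (by simp)
  have hγ : HasDerivAt (fun s : ℝ => u + s • v) v 0 := by
    simpa using ((hasDerivAt_id (0 : ℝ)).smul_const v).const_add u
  have h1 : HasFDerivAt (fderiv ℝ c) (fderiv ℝ (fderiv ℝ c) u) (u + (0 : ℝ) • v) := by
    simpa using (hd u).hasFDerivAt
  exact (ContinuousLinearMap.apply ℝ F v).hasFDerivAt.comp_hasDerivAt 0 (h1.comp_hasDerivAt 0 hγ)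

/-- First and second variation of a linear functional along a unitary orbit map, at a point where
the functional is critical on the orbit. -/
lemma exists_second_variation (E U : H → 𝔸) (ρ₀ : 𝔸) (hU : ContDiff ℝ ∞ U)
    (hE : ∀ u, E u = U u * ρ₀ * star (U u)) (hU1 : ∀ u, U u * star (U u) = 1)
    (hU2 : ∀ u, star (U u) * U u = 1) (l : 𝔸 →L[ℝ] ℝ) (uc v : H)
    (hcrit : ∀ S : 𝔸, star S = -S → l (S * E uc - E uc * S) = 0) :
    ∃ A : 𝔸, star A = -A ∧ fderiv ℝ E uc v = A * E uc - E uc * A ∧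
      fderiv ℝ (fderiv ℝ fun u => l (E u)) uc v v =
        l (A * (A * E uc - E uc * A) - (A * E uc - E uc * A) * A) := by
  set ρ := E uc with hρ
  set W := star (U uc) with hW
  have hEs : ContDiff ℝ ∞ E := by
    have : E = fun u => U u * ρ₀ * starL' ℝ (U u) := funext hE
    rw [this]
    exact (hU.mul contDiff_const).mul ((starL' ℝ (A := 𝔸)).toContinuousLinearMap.contDiff.comp hU)
  have hUd : Differentiable ℝ U := hU.differentiable (by simp)
  have hEd : Differentiable ℝ E := hEs.differentiable (by simp)
  have hcs : ContDiff ℝ ∞ fun u => l (E u) := l.contDiff.comp hEs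
  have hγ : ∀ s : ℝ, HasDerivAt (fun s : ℝ => uc + s • v) v s := fun s => by
    simpa using ((hasDerivAt_id s).smul_const v).const_add uc
  -- Recentring at `uc`: `V` is a curve of unitaries through `1` that conjugates `ρ` to `E (uc + s •
  -- v)`. Its velocity is `a` and its acceleration at `0` is `b`.
  set V : ℝ → 𝔸 := fun s => U (uc + s • v) * W with hV
  set a : ℝ → 𝔸 := fun s => fderiv ℝ U (uc + s • v) v * W with ha
  set b : 𝔸 := fderiv ℝ (fderiv ℝ U) uc v v * W with hb
  have hVd : ∀ s, HasDerivAt V (a s) s := fun s =>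
    ((hUd _).hasFDerivAt.comp_hasDerivAt s (hγ s)).mul_const W
  have had : HasDerivAt a b 0 := (hasDerivAt_fderiv_line hU uc v).mul_const W
  clear_value b
  have hV0 : V 0 = 1 := by simp [hV, hW, hU1]
  have hWW : star W = U uc := star_star _
  have hVV : ∀ s, V s * star (V s) = 1 := fun s => by
    simp only [hV, star_mul, hWW]
    rw [mul_assoc, ← mul_assoc W, hW, hU2, one_mul, hU1]
  have hEV : ∀ s : ℝ, E (uc + s • v) = V s * ρ * star (V s) := fun s => by
    simp only [hV, star_mul, hWW, hρ, hE]
    have h1 := hU2 uc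
    calc _ = U (uc + s • v) * (star (U uc) * U uc) * ρ₀ * (star (U uc) * U uc) *
          star (U (uc + s • v)) := by rw [h1]; simp
      _ = _ := by rw [hW]; noncomm_ring
  have hfirst : ∀ s, a s * star (V s) + V s * star (a s) = 0 := fun s => by
    have h1 := (hVd s).mul (hVd s).star
    have h2 : (V * fun s => star (V s)) = fun _ => (1 : 𝔸) := funext hVV
    rw [h2] at h1
    exact h1.unique (hasDerivAt_const s 1)
  have hA : star (a 0) = -a 0 := by
    have := hfirst 0
    rw [hV0] at this
    simpa [add_comm, eq_neg_iff_add_eq_zero] using this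
  have hsecond : b + a 0 * star (a 0) + (a 0 * star (a 0) + star b) = 0 := by
    have h1 := (had.mul (hVd 0).star).add ((hVd 0).mul had.star)
    have h2 : ((a * fun s => star (V s)) + (V * fun s => star (a s))) = fun _ => (0 : 𝔸) :=
      funext hfirst
    rw [h2] at h1
    have := h1.unique (hasDerivAt_const 0 0)
    simpa [hV0] using this
  have hdE : ∀ s, fderiv ℝ E (uc + s • v) v =
      a s * ρ * star (V s) + V s * ρ * star (a s) := fun s => by
    have h1 := (hEd (uc + s • v)).hasFDerivAt.comp_hasDerivAt s (hγ s)
    have h2 := hasDerivAt_conj (hVd s) ρ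
    rw [show (fun s => V s * ρ * star (V s)) = E ∘ fun s : ℝ => uc + s • v from
      funext fun s => (hEV s).symm] at h2
    exact h1.unique h2
  refine ⟨a 0, hA, ?_, ?_⟩
  · have := hdE 0
    rw [zero_smul, add_zero, hV0, hA] at this
    rw [this]
    simp [sub_eq_add_neg]
  · have h1 := hasDerivAt_fderiv_line hcs uc v
    have h2 := l.hasFDerivAt.comp_hasDerivAt 0 ((had.mul_const ρ |>.mul (hVd 0).star).add
      (((hVd 0).mul_const ρ).mul had.star))
    have h3 : (fun s : ℝ => fderiv ℝ (fun u => l (E u)) (uc + s • v) v) =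
        l ∘ (((fun s => a s * ρ) * fun s => star (V s)) +
          ((fun s => V s * ρ) * fun s => star (a s))) := by
      funext s
      have := l.hasFDerivAt.comp (uc + s • v) (hEd (uc + s • v)).hasFDerivAt
      have h4 : fderiv ℝ (fun u => l (E u)) (uc + s • v) = l.comp (fderiv ℝ E (uc + s • v)) :=
        this.fderiv
      simp only [Function.comp_apply, h4, ContinuousLinearMap.comp_apply, hdE]
      rfl
    rw [h3] at h1
    have h5 := h1.unique h2
    rw [h5, hV0, hA]
    -- Differentiating `V V† = 1` twice gives `b + b† = 2 a(0)²`, so `b - a(0)²` is skew. The second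
    -- derivative of `V ρ V†` at `0` is therefore `[b - a(0)², ρ] + [a(0), [a(0), ρ]]`, and `l`
    -- kills the first bracket by criticality.
    have h7 : star b = -b + a 0 * a 0 + a 0 * a 0 := by
      rw [hA] at hsecond
      refine sub_eq_zero.1 (Eq.trans ?_ hsecond)
      noncomm_ring
    have hS : star (b - a 0 * a 0) = -(b - a 0 * a 0) := by
      rw [star_sub, star_mul, hA, h7]
      noncomm_ring
    refine sub_eq_zero.1 (Eq.trans ?_ (hcrit _ hS))
    rw [← map_sub, h7]
    congr 1
    simp only [star_one]
    noncomm_ring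

end SecondVariation

/-! ### The Hessian form on the tangent space of the orbit -/

section Signature

variable {n : ℕ}

/-- The commutant of a Hermitian matrix with simple spectrum is commutative. -/
lemma commute_of_commute_simple {ρ X Y : Matrix (Fin n) (Fin n) ℂ} (hρ : ρ.IsHermitian)
    (hs : Function.Injective hρ.eigenvalues) (hX : Commute X ρ) (hY : Commute Y ρ) :
    Commute X Y := by
  set U : Matrix (Fin n) (Fin n) ℂ := hρ.eigenvectorUnitary.1 with hU
  set D : Matrix (Fin n) (Fin n) ℂ := Matrix.diagonal (RCLike.ofReal ∘ hρ.eigenvalues) with hD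
  have h1 : star U * U = 1 := Unitary.coe_star_mul_self hρ.eigenvectorUnitary
  have h2 : U * star U = 1 := Unitary.coe_mul_star_self hρ.eigenvectorUnitary
  have hspec : ρ = U * D * star U := by
    conv_lhs => rw [hρ.spectral_theorem, Unitary.conjStarAlgAut_apply]
  have key : ∀ Z, Commute Z ρ → ∃ z, star U * Z * U = Matrix.diagonal z := by
    intro Z hZ
    have hc : (star U * Z * U) * D = D * (star U * Z * U) := by
      have h3 : star U * (Z * ρ) * U = star U * (ρ * Z) * U := by rw [hZ.eq]
      rw [hspec] at h3
      calc _ = star U * (Z * (U * D * star U)) * U := by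
            simp only [mul_assoc, h1, mul_one]
        _ = _ := h3
        _ = (star U * U) * D * (star U * Z * U) := by simp only [mul_assoc]
        _ = _ := by rw [h1, one_mul]
    refine ⟨fun i => (star U * Z * U) i i, ?_⟩
    ext i j
    by_cases hij : i = j
    · subst hij
      simp
    · rw [Matrix.diagonal_apply_ne _ hij]
      have h4 := congrFun (congrFun hc i) j
      rw [hD, Matrix.mul_diagonal, Matrix.diagonal_mul] at h4
      -- In an eigenbasis of `ρ`, commutation reads `(λᵢ - λⱼ) zᵢⱼ = 0`; simplicity of the spectrum
      -- kills the off-diagonal entries.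
      have h5 : ((hρ.eigenvalues i : ℂ) - hρ.eigenvalues j) * (star U * Z * U) i j = 0 := by
        have h4' : (star U * Z * U) i j * (hρ.eigenvalues j : ℂ) =
          (hρ.eigenvalues i : ℂ) * (star U * Z * U) i j := h4
        rw [sub_mul, ← h4', mul_comm, sub_self]
      refine (mul_eq_zero.1 h5).resolve_left ?_
      exact fun h => hij (hs (Complex.ofReal_injective (sub_eq_zero.1 h)))
  obtain ⟨x, hx⟩ := key X hX
  obtain ⟨y, hy⟩ := key Y hY
  have hrec : ∀ Z, Z = U * (star U * Z * U) * star U := fun Z => by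
    calc Z = (U * star U) * Z * (U * star U) := by rw [h2, one_mul, mul_one]
      _ = _ := by simp only [mul_assoc]
  have hprod : ∀ a b, (U * Matrix.diagonal a * star U) * (U * Matrix.diagonal b * star U) =
      U * (Matrix.diagonal a * Matrix.diagonal b) * star U := fun a b => by
    calc _ = U * Matrix.diagonal a * (star U * U) * Matrix.diagonal b * star U := by
          simp only [mul_assoc]
      _ = _ := by rw [h1, mul_one]; simp only [mul_assoc]
  rw [hrec X, hrec Y, hx, hy, commute_iff_eq, hprod, hprod, Matrix.diagonal_mul_diagonal,
    Matrix.diagonal_mul_diagonal]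
  simp only [mul_comm]

/-- The commutant of a unitary conjugate of a Hermitian matrix with simple spectrum is
commutative. -/
lemma commute_of_commute_orbit {ρ₀ ρ X Y : Matrix (Fin n) (Fin n) ℂ} (hρ₀ : ρ₀.IsHermitian)
    (hs : Function.Injective hρ₀.eigenvalues) (hρ : ρ ∈ orbit ρ₀) (hX : Commute X ρ)
    (hY : Commute Y ρ) : Commute X Y := by
  obtain ⟨U, hU, rfl⟩ := hρ
  have hU' := Matrix.mem_specialUnitaryGroup_iff.1 hU
  have h1 : Uᴴ * U = 1 := Matrix.mem_unitaryGroup_iff'.1 hU'.1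
  have h2 : U * Uᴴ = 1 := Matrix.mem_unitaryGroup_iff.1 hU'.1
  have key : ∀ Z, Commute Z (U * ρ₀ * Uᴴ) → Commute (Uᴴ * Z * U) ρ₀ := fun Z hZ => by
    rw [commute_iff_eq]
    calc _ = Uᴴ * (Z * (U * ρ₀ * Uᴴ)) * U := by simp only [mul_assoc, h1, mul_one]
      _ = Uᴴ * ((U * ρ₀ * Uᴴ) * Z) * U := by rw [hZ.eq]
      _ = (Uᴴ * U) * ρ₀ * (Uᴴ * Z * U) := by simp only [mul_assoc]
      _ = _ := by rw [h1, one_mul]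
  have hc := commute_of_commute_simple hρ₀ hs (key X hX) (key Y hY)
  have hXY : ∀ A B, A * B = U * ((Uᴴ * A * U) * (Uᴴ * B * U)) * Uᴴ := fun A B => by
    calc A * B = (U * Uᴴ) * A * (U * Uᴴ) * B * (U * Uᴴ) := by simp only [h2, one_mul, mul_one]
      _ = _ := by simp only [mul_assoc]
  rw [commute_iff_eq, hXY X Y, hc.eq, ← hXY Y X]

lemma isHermitian_of_mem_orbit {ρ₀ ρ : Matrix (Fin n) (Fin n) ℂ} (hρ₀ : ρ₀.IsHermitian)
    (hρ : ρ ∈ orbit ρ₀) : ρ.IsHermitian := by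
  obtain ⟨U, hU, rfl⟩ := hρ
  exact Matrix.isHermitian_mul_mul_conjTranspose U hρ₀

/-- Conjugation by `U` preserves `su n` and intertwines the brackets with `ρ₀` and with `U ρ₀ U†`.
-/
lemma finrank_tangentSpace_of_mem_orbit {ρ₀ ρ : Matrix (Fin n) (Fin n) ℂ} (hρ : ρ ∈ orbit ρ₀) :
    Module.finrank ℝ (tangentSpace ρ) = orbitDim ρ₀ := by
  obtain ⟨U, hU, rfl⟩ := hρ
  have hU' := Matrix.mem_specialUnitaryGroup_iff.1 hU
  have h1 : Uᴴ * U = 1 := Matrix.mem_unitaryGroup_iff'.1 hU'.1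
  have h2 : U * Uᴴ = 1 := Matrix.mem_unitaryGroup_iff.1 hU'.1
  let e : Matrix (Fin n) (Fin n) ℂ ≃ₗ[ℝ] Matrix (Fin n) (Fin n) ℂ :=
    { toFun := fun X => U * X * Uᴴ
      invFun := fun X => Uᴴ * X * U
      map_add' := fun X Y => by simp only [mul_add, add_mul]
      map_smul' := fun c X => by simp
      left_inv := fun X => by
        calc Uᴴ * (U * X * Uᴴ) * U = (Uᴴ * U) * X * (Uᴴ * U) := by simp only [mul_assoc]
          _ = X := by simp [h1]
      right_inv := fun X => by
        calc U * (Uᴴ * X * U) * Uᴴ = (U * Uᴴ) * X * (U * Uᴴ) := by simp only [mul_assoc]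
          _ = X := by simp [h2] }
  have hsu : ∀ Ω, Ω ∈ su n ↔ U * Ω * Uᴴ ∈ su n := by
    have half : ∀ V Ω : Matrix (Fin n) (Fin n) ℂ, Vᴴ * V = 1 → Ω ∈ su n → V * Ω * Vᴴ ∈ su n := by
      rintro V Ω hV ⟨hΩ, ht⟩
      refine ⟨?_, ?_⟩
      · simp [Matrix.conjTranspose_mul, hΩ, mul_assoc]
      · rw [Matrix.trace_mul_cycle, hV, one_mul, ht]
    refine fun Ω => ⟨half U Ω h1, fun h => ?_⟩
    have := half Uᴴ _ (by simpa using h2) h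
    rw [Matrix.conjTranspose_conjTranspose] at this
    convert this using 1
    exact (e.left_inv Ω).symm
  have hmap : tangentSpace (U * ρ₀ * Uᴴ) = (tangentSpace ρ₀).map (e : _ →ₗ[ℝ] _) := by
    have hcomm : ∀ Ω, adMap (U * ρ₀ * Uᴴ) (U * Ω * Uᴴ) = e (adMap ρ₀ Ω) := fun Ω => by
      change (U * ρ₀ * Uᴴ) * (U * Ω * Uᴴ) - (U * Ω * Uᴴ) * (U * ρ₀ * Uᴴ) =
        U * (ρ₀ * Ω - Ω * ρ₀) * Uᴴ
      calc _ = U * ρ₀ * (Uᴴ * U) * Ω * Uᴴ - U * Ω * (Uᴴ * U) * ρ₀ * Uᴴ := by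
            simp only [mul_assoc]
        _ = _ := by rw [h1]; noncomm_ring
    ext η
    simp only [tangentSpace, Submodule.mem_map]
    constructor
    · rintro ⟨Ω, hΩ, rfl⟩
      refine ⟨_, ⟨Uᴴ * Ω * U, (hsu _).2 ?_, rfl⟩, ?_⟩
      · convert hΩ using 1
        exact e.right_inv Ω
      · refine (hcomm _).symm.trans (congrArg _ (e.right_inv Ω))
    · rintro ⟨_, ⟨Ω, hΩ, rfl⟩, rfl⟩
      exact ⟨_, (hsu _).1 hΩ, hcomm Ω⟩
  rw [hmap, orbitDim, LinearEquiv.finrank_map_eq]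

lemma comm_mem_su_of_isHermitian {X Y : Matrix (Fin n) (Fin n) ℂ} (hX : X.IsHermitian)
    (hY : Y.IsHermitian) : X * Y - Y * X ∈ su n := by
  refine ⟨?_, ?_⟩
  · rw [Matrix.conjTranspose_sub, Matrix.conjTranspose_mul, Matrix.conjTranspose_mul, hX.eq, hY.eq,
      neg_sub]
  · rw [Matrix.trace_sub, Matrix.trace_mul_comm, sub_self]

open scoped ComplexOrder in
-- For skew `A`, `-tr (A²)` is the squared Hilbert–Schmidt norm.
lemma eq_zero_of_mem_su {A : Matrix (Fin n) (Fin n) ℂ} (hA : A ∈ su n)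
    (h : (A * A).trace.re = 0) : A = 0 := by
  rw [← Matrix.trace_conjTranspose_mul_self_eq_zero_iff]
  have h1 : (Aᴴ * A).trace.re = 0 := by rw [hA.1]; simpa using h
  refine Complex.ext h1 ?_
  have : star (Aᴴ * A).trace = (Aᴴ * A).trace := by
    rw [← Matrix.trace_conjTranspose, Matrix.conjTranspose_mul, Matrix.conjTranspose_conjTranspose]
  exact Complex.conj_eq_iff_im.1 this

/-- Scalars commute with `ρ`, so the trace of `A` can be removed without changing the bracket. -/
lemma skew_comm_mem_tangentSpace {A : Matrix (Fin n) (Fin n) ℂ} (hA : Aᴴ = -A)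
    (ρ : Matrix (Fin n) (Fin n) ℂ) : A * ρ - ρ * A ∈ tangentSpace ρ := by
  rcases Nat.eq_zero_or_pos n with rfl | hn
  · have : A * ρ - ρ * A = 0 := Subsingleton.elim _ _
    rw [this]
    exact Submodule.zero_mem _
  have hn' : (n : ℂ) ≠ 0 := by exact_mod_cast hn.ne'
  refine ⟨(A.trace / n) • (1 : Matrix (Fin n) (Fin n) ℂ) - A, ⟨?_, ?_⟩, ?_⟩
  · have ht : star A.trace = -A.trace := by
      rw [← Matrix.trace_conjTranspose, hA, Matrix.trace_neg]
    rw [Matrix.conjTranspose_sub, Matrix.conjTranspose_smul, Matrix.conjTranspose_one, hA, star_div₀,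
      ht, star_natCast, neg_div, neg_smul]
    abel
  · rw [Matrix.trace_sub, Matrix.trace_smul, Matrix.trace_one]
    simp [hn']
  · change ρ * (_ - A) - (_ - A) * ρ = _
    simp only [mul_sub, sub_mul, mul_smul_comm, smul_mul_assoc, mul_one, one_mul]
    abel

lemma trace_comm_mul_assoc (A B C : Matrix (Fin n) (Fin n) ℂ) :
    ((A * B - B * A) * C).trace = (A * (B * C - C * B)).trace := by
  rw [sub_mul, mul_sub, Matrix.trace_sub, Matrix.trace_sub, mul_assoc B, Matrix.trace_mul_comm B]
  simp only [mul_assoc]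

lemma trace_comm_mul_eq (A B C : Matrix (Fin n) (Fin n) ℂ) :
    ((A * B - B * A) * C).trace = ((C * A - A * C) * B).trace := by
  rw [Matrix.trace_mul_comm, trace_comm_mul_assoc]

/-- Testing criticality against the tangent vector `[ρ, [θ, ρ]]` gives `Re tr ([θ, ρ]²) = 0`, and
`[θ, ρ]` lies in `su n`. -/
lemma commute_of_isKinematicCritical {θ ρ₀ ρ : Matrix (Fin n) (Fin n) ℂ} (hρ₀ : ρ₀.IsHermitian)
    (hθ : θ.IsHermitian) (hc : IsKinematicCritical θ ρ₀ ρ) : Commute θ ρ := by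
  have hρ := isHermitian_of_mem_orbit hρ₀ hc.1
  have hsu := comm_mem_su_of_isHermitian hθ hρ
  let l : Matrix (Fin n) (Fin n) ℂ →ₗ[ℝ] ℝ :=
    Complex.reLm ∘ₗ (Matrix.traceLinearMap (Fin n) ℝ ℂ) ∘ₗ (LinearMap.mulRight ℝ θ)
  have hl : HasFDerivAt (kinematicCost θ) l.toContinuousLinearMap ρ :=
    l.toContinuousLinearMap.hasFDerivAt
  have h1 := hc.2 _ ⟨_, hsu, rfl⟩
  rw [hl.fderiv] at h1
  have h2 : ((ρ * (θ * ρ - ρ * θ) - (θ * ρ - ρ * θ) * ρ) * θ).trace.re = 0 := h1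
  rw [trace_comm_mul_eq] at h2
  exact sub_eq_zero.1 (eq_zero_of_mem_su hsu h2)

/-- By cyclicity and the Jacobi identity the two sides differ, up to sign, by `tr ([θ, ρ] [S, S'])`.
This is the symmetry of the Hessian form. -/
lemma trace_comm_mul_comm {θ ρ : Matrix (Fin n) (Fin n) ℂ} (S S' : Matrix (Fin n) (Fin n) ℂ)
    (h : Commute θ ρ) :
    ((θ * S - S * θ) * (ρ * S' - S' * ρ)).trace =
      ((θ * S' - S' * θ) * (ρ * S - S * ρ)).trace := by
  have h1 : ((θ * ρ - ρ * θ) * (S * S' - S' * S)).trace = 0 := by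
    rw [h.eq, sub_self, zero_mul, Matrix.trace_zero]
  rw [trace_comm_mul_assoc] at h1 ⊢
  rw [trace_comm_mul_assoc, ← sub_eq_zero, ← Matrix.trace_sub, ← h1]
  congr 1
  noncomm_ring

/-- A linear section of `Ω ↦ [ρ, Ω]` on the tangent space of the orbit. -/
lemma exists_tangentSpace_section (ρ : Matrix (Fin n) (Fin n) ℂ) :
    ∃ s : tangentSpace ρ →ₗ[ℝ] Matrix (Fin n) (Fin n) ℂ, (∀ η, s η ∈ su n) ∧
      ∀ η : tangentSpace ρ, ρ * s η - s η * ρ = η := by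
  obtain ⟨s, hs⟩ := ((adMap ρ).submoduleMap (su n)).exists_rightInverse_of_surjective
    (LinearMap.range_eq_top.2 ((adMap ρ).submoduleMap_surjective (su n)))
  exact ⟨(su n).subtype ∘ₗ s, fun η => (s η).2,
    fun η => congrArg Subtype.val (LinearMap.congr_fun hs η)⟩

open scoped ComplexOrder in
/-- The quadratic form `A ↦ Re tr ([A, [A, ρ]] θ)` in terms of `[A, ρ]`, at a critical point, has a
nondegenerate signature decomposition. -/
lemma exists_signature {θ ρ₀ ρ : Matrix (Fin n) (Fin n) ℂ} (hρ₀ : ρ₀.IsHermitian)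
    (hθ : θ.IsHermitian) (hρs : Function.Injective hρ₀.eigenvalues)
    (hθs : Function.Injective hθ.eigenvalues) (hc : IsKinematicCritical θ ρ₀ ρ) :
    ∃ (w : Fin (orbitDim ρ₀) → ℝ) (τ : tangentSpace ρ ≃ₗ[ℝ] (Fin (orbitDim ρ₀) → ℝ)),
      (∀ i, w i = -1 ∨ w i = 1) ∧ ∀ (A : Matrix (Fin n) (Fin n) ℂ) (hA : Aᴴ = -A),
        ((A * (A * ρ - ρ * A) - (A * ρ - ρ * A) * A) * θ).trace.re =
          ∑ i, w i * (τ ⟨_, skew_comm_mem_tangentSpace hA ρ⟩ i) ^ 2 := by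
  have hρ := isHermitian_of_mem_orbit hρ₀ hc.1
  have hθρ := commute_of_isKinematicCritical hρ₀ hθ hc
  obtain ⟨s, hsu, hs'⟩ := exists_tangentSpace_section ρ
  -- The form uses an arbitrary preimage `s η` of `η` under `[ρ, ·]`; the end of the proof checks
  -- that on the diagonal it agrees with the value computed from any skew `A`.
  let b : LinearMap.BilinForm ℝ (tangentSpace ρ) := LinearMap.mk₂ ℝ
    (fun η η' => -((θ * s η - s η * θ) *
      (η' : Matrix (Fin n) (Fin n) ℂ)).trace.re)
    (fun a a' c => by
      simp only [map_add, mul_add, add_mul, sub_mul, Matrix.trace_add,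
        Matrix.trace_sub, Complex.add_re, Complex.sub_re]
      ring)
    (fun r a c => by
      simp only [map_smul, mul_smul_comm, smul_mul_assoc, ← smul_sub,
        Matrix.trace_smul, Complex.smul_re, smul_neg])
    (fun a c c' => by
      simp only [Submodule.coe_add, mul_add, Matrix.trace_add, Complex.add_re]
      ring)
    (fun r a c => by
      simp only [Submodule.coe_smul, mul_smul_comm, Matrix.trace_smul, Complex.smul_re, smul_neg])
  have hb : ∀ η η', b η η' = -((θ * s η - s η * θ) *
      (η' : Matrix (Fin n) (Fin n) ℂ)).trace.re := fun η η' => rfl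
  have hsymm : ∀ η η', b η η' = b η' η := fun η η' => by
    rw [hb, hb, ← hs' η', trace_comm_mul_comm _ _ hθρ, hs' η]
  -- Put `X = [θ, S]`. Testing against `[ρ, [X, ρ]]` gives `tr ([X, ρ]²) = 0` in real part, so `X`
  -- commutes with `ρ`, hence with `θ` by simplicity of `ρ₀`. Then `tr (X²) = -tr (S [θ, X]) = 0`,
  -- so `S` commutes with `θ`, hence with `ρ` by simplicity of `θ`, and `η = [ρ, S] = 0`.
  have hnd : b.SeparatingLeft := by
    intro η hη
    set S : Matrix (Fin n) (Fin n) ℂ := s η with hS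
    have hSsk : Sᴴ = -S := (hsu η).1
    set X := θ * S - S * θ with hX
    have hXh : X.IsHermitian := by
      rw [Matrix.IsHermitian, hX, Matrix.conjTranspose_sub, Matrix.conjTranspose_mul,
        Matrix.conjTranspose_mul, hSsk, hθ.eq]
      noncomm_ring
    have hA' := comm_mem_su_of_isHermitian hXh hρ
    have h1 := hη ⟨_, _, hA', rfl⟩
    rw [hb, neg_eq_zero] at h1
    have h2 : (X * (ρ * (X * ρ - ρ * X) - (X * ρ - ρ * X) * ρ)).trace.re = 0 := h1
    rw [← trace_comm_mul_assoc] at h2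
    have hXρ : Commute X ρ := sub_eq_zero.1 (eq_zero_of_mem_su hA' h2)
    have hXθ : Commute X θ := commute_of_commute_orbit hρ₀ hρs hc.1 hXρ hθρ
    have h5 : X = 0 := by
      rw [← Matrix.trace_conjTranspose_mul_self_eq_zero_iff, hXh.eq]
      conv_lhs => enter [1, 1]; rw [hX]
      rw [← neg_sub, neg_mul, Matrix.trace_neg, trace_comm_mul_assoc, hXθ.eq, sub_self, mul_zero,
        Matrix.trace_zero, neg_zero]
    have hSθ : Commute S θ := (sub_eq_zero.1 h5).symm
    have hSρ : Commute S ρ := commute_of_commute_simple hθ hθs hSθ hθρ.symm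
    apply Subtype.ext
    rw [← hs' η, ← hS, hSρ.eq, sub_self]
    rfl
  have hass : QuadraticMap.associated (R := ℝ) b.toQuadraticMap = b :=
    QuadraticMap.associated_left_inverse ℝ hsymm
  -- Sylvester's law of inertia; nondegeneracy excludes zero weights.
  obtain ⟨w, hw, ⟨τ⟩⟩ := QuadraticForm.equivalent_one_neg_one_weighted_sum_squared
    (LinearMap.BilinMap.toQuadraticMap b) (by rw [hass]; exact hnd)
  rw [← finrank_tangentSpace_of_mem_orbit hc.1]
  refine ⟨w, τ.toLinearEquiv, hw, fun A hA => ?_⟩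
  set η : tangentSpace ρ := ⟨_, skew_comm_mem_tangentSpace hA ρ⟩ with hη
  have hηv : (η : Matrix (Fin n) (Fin n) ℂ) = A * ρ - ρ * A := rfl
  have h1 : ∑ i, w i * (τ.toLinearEquiv η i) ^ 2 = b η η := by
    have := τ.map_app η
    rw [QuadraticMap.weightedSumSquares_apply] at this
    simp only [sq]
    exact this
  rw [h1, hb, hηv, ← hηv]
  -- `s η` and `-A` have the same bracket with `ρ`, so their difference commutes with `ρ` and
  -- therefore with `θ`; either one may be used in the form.
  have hcom : Commute (s η + A) ρ := by
    have := hs' η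
    rw [hηv] at this
    rw [commute_iff_eq, add_mul, mul_add, ← sub_eq_zero]
    refine Eq.trans ?_ (sub_eq_zero.2 this.symm)
    abel
  have hcomθ := commute_of_commute_orbit hρ₀ hρs hc.1 hcom hθρ
  have h2 : θ * s η - s η * θ = A * θ - θ * A := by
    have := hcomθ.eq
    rw [add_mul, mul_add, ← sub_eq_zero] at this
    refine sub_eq_zero.1 (Eq.trans ?_ (neg_eq_zero.2 this))
    abel
  rw [h2, ← Complex.neg_re, ← Matrix.trace_neg, ← neg_mul, neg_sub, trace_comm_mul_eq]

end Signature

/-! ### Smooth charts and the Morse lemma -/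

section MorseLemma

/-- The inverse function theorem for smooth maps on an open set, with smoothness of the inverse on
the whole target. -/
lemma exists_smooth_chart {E F : Type*} [NormedAddCommGroup E] [NormedSpace ℝ E] [CompleteSpace E]
    [NormedAddCommGroup F] [NormedSpace ℝ F] {h : E → F} {a : E} {s : Set E}
    (hs : IsOpen s) (ha : a ∈ s) (hh : ContDiffOn ℝ ∞ h s) (h' : E ≃L[ℝ] F)
    (hd : HasFDerivAt h (h' : E →L[ℝ] F) a) :
    ∃ e : OpenPartialHomeomorph E F, a ∈ e.source ∧ e.source ⊆ s ∧ (∀ x, e x = h x) ∧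
      ContDiffOn ℝ ∞ e e.source ∧ ContDiffOn ℝ ∞ e.symm e.target := by
  have hca : ContDiffAt ℝ ∞ h a := hh.contDiffAt (hs.mem_nhds ha)
  -- The source is cut down to points with invertible derivative, so that the inverse is smooth on
  -- the whole target and not only at the image of `a`.
  have hopen : IsOpen (s ∩ fderiv ℝ h ⁻¹' Set.range ((↑) : (E ≃L[ℝ] F) → E →L[ℝ] F)) :=
    (hh.continuousOn_fderiv_of_isOpen hs (by simp)).isOpen_inter_preimage hs
      ContinuousLinearEquiv.isOpen
  set e := (hca.toOpenPartialHomeomorph h hd (by simp)).restrOpen _ hopen with he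
  have hec : ∀ x, e x = h x := fun x => rfl
  have hsrc : ∀ x ∈ e.source, x ∈ s ∧ ∃ g : E ≃L[ℝ] F, (g : E →L[ℝ] F) = fderiv ℝ h x :=
    fun x hx => hx.2
  refine ⟨e, ⟨hca.mem_toOpenPartialHomeomorph_source hd (by simp), ha, h', hd.fderiv.symm⟩,
    fun x hx => (hsrc x hx).1, hec, hh.mono fun x hx => (hsrc x hx).1, fun y hy => ?_⟩
  obtain ⟨hx, g, hg⟩ := hsrc _ (e.map_target hy)
  have hcx : ContDiffAt ℝ ∞ h (e.symm y) := hh.contDiffAt (hs.mem_nhds hx)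
  have hdx : HasFDerivAt h (g : E →L[ℝ] F) (e.symm y) := by
    rw [hg]
    exact (hcx.differentiableAt (by simp)).hasFDerivAt
  exact (e.contDiffAt_symm hy hdx hcx).contDiffWithinAt

/-- Smooth dependence on the parameter of `y ↦ ∫₀¹ a(s) G(s y) ds`. -/
lemma contDiff_integral_smul_dilation {Y F : Type*} [NormedAddCommGroup Y] [NormedSpace ℝ Y]
    [NormedAddCommGroup F] [NormedSpace ℝ F] {a : ℝ → ℝ} (ha : Continuous a) {G : Y → F}
    (hG : ContDiff ℝ ∞ G) :
    ContDiff ℝ ∞ fun y => ∫ s in (0 : ℝ)..1, a s • G (s • y) := by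
  -- The integral is the convolution at `0` of `a` cut to `(0, 1]` with `t ↦ χ t • G (-t • y)`. The
  -- bump supplies compact support and equals `1` on `[-1, 1]`, where it is evaluated.
  let χ : ContDiffBump (0 : ℝ) := ⟨1, 2, one_pos, one_lt_two⟩
  let f : ℝ → ℝ := (Set.Ioc (0 : ℝ) 1).indicator a
  let g : Y → ℝ → F := fun y t => χ t • G ((-t) • y)
  have hf : LocallyIntegrable f :=
    ((ha.integrableOn_Icc (a := 0) (b := 1)).mono_set Set.Ioc_subset_Icc_self
      |>.integrable_indicator measurableSet_Ioc).locallyIntegrable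
  have hg : ContDiff ℝ ∞ (Function.uncurry g) := by
    refine ContDiff.smul (χ.contDiff.comp contDiff_snd) (hG.comp ?_)
    exact contDiff_snd.neg.smul contDiff_fst
  have h0 : ∀ (y : Y) (t : ℝ), y ∈ (Set.univ : Set Y) → t ∉ Metric.closedBall (0 : ℝ) 2 →
      g y t = 0 := by
    intro y t _ ht
    have : χ t = 0 := χ.zero_of_le_dist (le_of_lt (by simpa using ht))
    simp [g, this]
  have h1 := contDiffOn_convolution_right_with_param (μ := volume) (n := ⊤)
    (ContinuousLinearMap.lsmul ℝ ℝ) isOpen_univ (isCompact_closedBall _ _) h0 hf hg.contDiffOn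
  rw [Set.univ_prod_univ, contDiffOn_univ] at h1
  have h2 := h1.comp (contDiff_id.prodMk (contDiff_const (c := (0 : ℝ))))
  convert h2 using 1
  funext y
  simp only [Function.comp_apply, id, convolution, f, g, ContinuousLinearMap.lsmul_apply]
  rw [intervalIntegral.integral_of_le zero_le_one, ← integral_indicator measurableSet_Ioc]
  refine integral_congr_ae (Filter.Eventually.of_forall fun t => ?_)
  by_cases ht : t ∈ Set.Ioc (0 : ℝ) 1
  · have : χ (-t) = 1 := by
      refine χ.one_of_mem_closedBall ?_
      simp only [mem_closedBall_zero_iff, norm_neg, Real.norm_eq_abs]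
      exact abs_le.2 ⟨by linarith [ht.1], ht.2⟩
    simp [Set.indicator_of_mem ht, this]
  · simp [Set.indicator_of_notMem ht]

/-- Taylor's formula of order two with integral remainder at a critical point. -/
lemma taylor_two_of_critical {Y : Type*} [NormedAddCommGroup Y] [NormedSpace ℝ Y] {f : Y → ℝ}
    (hf : ContDiff ℝ ∞ f) (h0 : fderiv ℝ f 0 = 0) (y : Y) :
    f y = f 0 + ∫ s in (0 : ℝ)..1, (1 - s) * fderiv ℝ (fderiv ℝ f) (s • y) y y := by
  have hf1 : ContDiff ℝ ∞ (fderiv ℝ f) := hf.fderiv_right (by simp)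
  have hf2 : ContDiff ℝ ∞ (fderiv ℝ (fderiv ℝ f)) := hf1.fderiv_right (by simp)
  have hγ : ∀ s : ℝ, HasDerivAt (fun s : ℝ => s • y) y s := fun s => by
    simpa using (hasDerivAt_id s).smul_const y
  have hd1 : ∀ s : ℝ, HasDerivAt (fun s : ℝ => f (s • y)) (fderiv ℝ f (s • y) y) s := fun s =>
    ((hf.differentiable (by simp)) _).hasFDerivAt.comp_hasDerivAt s (hγ s)
  have hd2 : ∀ s : ℝ, HasDerivAt (fun s : ℝ => fderiv ℝ f (s • y) y)
      (fderiv ℝ (fderiv ℝ f) (s • y) y y) s := fun s =>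
    (ContinuousLinearMap.apply ℝ ℝ y).hasFDerivAt.comp_hasDerivAt s
      (((hf1.differentiable (by simp)) _).hasFDerivAt.comp_hasDerivAt s (hγ s))
  have hc1 : Continuous fun s : ℝ => fderiv ℝ f (s • y) y :=
    continuous_iff_continuousAt.2 fun s => (hd2 s).continuousAt
  have hc2 : Continuous fun s : ℝ => fderiv ℝ (fderiv ℝ f) (s • y) y y := by
    have := hf2.continuous
    fun_prop
  rw [intervalIntegral.integral_mul_deriv_eq_deriv_mul (u := fun s => 1 - s) (u' := fun _ => -1)
    (fun s _ => (hasDerivAt_id s).const_sub 1) (fun s _ => hd2 s) (by simp)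
    (hc2.intervalIntegrable _ _)]
  have hI := intervalIntegral.integral_eq_sub_of_hasDerivAt (a := 0) (b := 1) (fun s _ => hd1 s)
    (hc1.intervalIntegrable _ _)
  simp only [neg_mul, one_mul, intervalIntegral.integral_neg, hI]
  simp [h0]

variable {Y : Type*} [NormedAddCommGroup Y] [InnerProductSpace ℝ Y] [CompleteSpace Y]

/-- The Riesz isomorphism from functionals to vectors, as a real-linear bounded operator. -/
def riesz (Y : Type*) [NormedAddCommGroup Y] [InnerProductSpace ℝ Y] [CompleteSpace Y] :
    (Y →L[ℝ] ℝ) →L[ℝ] Y :=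
  LinearMap.mkContinuous
    { toFun := fun l => (InnerProductSpace.toDual ℝ Y).symm l
      map_add' := fun l m => map_add _ l m
      map_smul' := fun c l => by simp } 1 fun l => by simp

lemma inner_riesz (l : Y →L[ℝ] ℝ) (z : Y) : inner ℝ (riesz Y l) z = l z :=
  InnerProductSpace.toDual_symm_apply

/-- Near `1`, squaring has a smooth inverse that is compatible with a continuous involution. -/
lemma exists_smooth_sqrt {A : Type*} [NormedRing A] [NormedAlgebra ℝ A] [CompleteSpace A] :
    ∃ (r : A → A) (s : Set A), IsOpen s ∧ 1 ∈ s ∧ r 1 = 1 ∧ ContDiffOn ℝ ∞ r s ∧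
      (∀ x ∈ s, r x * r x = x) ∧ ∀ᶠ z in nhds (1 : A), r (z * z) = z := by
  have hc : ContDiff ℝ ∞ fun x : A => x * x := contDiff_id.mul contDiff_id
  have hd : HasFDerivAt (fun x : A => x * x)
      ((ContinuousLinearEquiv.smulLeft (Units.mk0 (2 : ℝ) two_ne_zero) : A ≃L[ℝ] A) :
        A →L[ℝ] A) 1 := by
    have := (hasFDerivAt_id (𝕜 := ℝ) (1 : A)).mul' (hasFDerivAt_id (𝕜 := ℝ) (1 : A))
    refine this.congr_fderiv ?_
    ext x
    simp [Units.smul_def, two_smul]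
  obtain ⟨e, h1, -, he, -, hes⟩ := exists_smooth_chart isOpen_univ (Set.mem_univ _) hc.contDiffOn _ hd
  have he1 : e 1 = 1 := by simp [he]
  refine ⟨e.symm, e.target, e.open_target, he1 ▸ e.map_source h1, ?_, hes, fun x hx => ?_, ?_⟩
  · conv_lhs => rw [← he1, e.left_inv h1]
  · rw [← he, e.right_inv hx]
  · filter_upwards [e.open_source.mem_nhds h1] with z hz
    rw [← he, e.left_inv hz]

/-- **Morse lemma** for a smooth function with a critical point at `0` whose Hessian is twice the
bilinear form of a self-adjoint involution. -/
theorem morse_lemma {f : Y → ℝ} (hf : ContDiff ℝ ∞ f) (h0 : fderiv ℝ f 0 = 0) (J : Y →L[ℝ] Y)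
    (hJ : J * J = 1) (hJs : star J = J)
    (hH : ∀ x y, fderiv ℝ (fderiv ℝ f) 0 x y = 2 * inner ℝ (J x) y) :
    ∃ e : OpenPartialHomeomorph Y Y, 0 ∈ e.source ∧ e 0 = 0 ∧ ContDiffOn ℝ ∞ e e.source ∧
      ContDiffOn ℝ ∞ e.symm e.target ∧
      ∀ y ∈ e.source, f y = f 0 + inner ℝ (J (e y)) (e y) := by
  have hf2 : ContDiff ℝ ∞ (fderiv ℝ (fderiv ℝ f)) :=
    (hf.fderiv_right (m := ∞) (by simp)).fderiv_right (by simp)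
  let G : Y → Y →L[ℝ] Y := fun y => (riesz Y).comp (fderiv ℝ (fderiv ℝ f) y)
  have hG : ContDiff ℝ ∞ G := contDiff_const.clm_comp hf2
  have hGi : ∀ y x z, inner ℝ (G y x) z = fderiv ℝ (fderiv ℝ f) y x z := fun y x z =>
    inner_riesz _ _
  -- With this averaged Hessian Taylor's formula reads `f y = f 0 + ⟪S y y, y⟫`. As `1 - s` has
  -- integral `1/2` on `[0, 1]` and the Hessian at `0` is `2 J`, one gets `S 0 = J`.
  let S : Y → Y →L[ℝ] Y := fun y => ∫ s in (0 : ℝ)..1, (1 - s) • G (s • y)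
  have hS : ContDiff ℝ ∞ S := contDiff_integral_smul_dilation (by fun_prop) hG
  have hSi : ∀ y x z, inner ℝ (S y x) z =
      ∫ s in (0 : ℝ)..1, (1 - s) * fderiv ℝ (fderiv ℝ f) (s • y) x z := by
    intro y x z
    have hint : IntervalIntegrable (fun s : ℝ => (1 - s) • G (s • y)) volume 0 1 := by
      have := hG.continuous
      exact (by fun_prop : Continuous fun s : ℝ => (1 - s) • G (s • y)).intervalIntegrable _ _
    have := ContinuousLinearMap.intervalIntegral_comp_comm
      ((innerSL ℝ z).comp (ContinuousLinearMap.apply ℝ Y x)) hint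
    rw [real_inner_comm]
    refine Eq.trans this.symm (intervalIntegral.integral_congr fun s _ => ?_)
    change inner ℝ z (((1 - s) • G (s • y)) x) = _
    rw [smul_apply, inner_smul_right, real_inner_comm, hGi]
  have hSsa : ∀ y, star (S y) = S y := by
    intro y
    rw [ContinuousLinearMap.star_eq_adjoint, ← ContinuousLinearMap.isSelfAdjoint_iff',
      ContinuousLinearMap.isSelfAdjoint_iff_isSymmetric]
    intro x z
    change inner ℝ (S y x) z = inner ℝ x (S y z)
    rw [real_inner_comm _ x, hSi, hSi]
    refine intervalIntegral.integral_congr fun s _ => ?_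
    have : IsSymmSndFDerivAt ℝ f (s • y) :=
      hf.contDiffAt.isSymmSndFDerivAt (by
        rw [minSmoothness_of_isRCLikeNormedField]
        exact WithTop.coe_le_coe.2 (le_top : (2 : ℕ∞) ≤ ⊤))
    simp only [this x z]
  have hS0 : S 0 = J := by
    ext x
    refine ext_inner_right ℝ fun z => ?_
    rw [hSi]
    simp only [smul_zero, hH, intervalIntegral.integral_mul_const]
    rw [intervalIntegral.integral_sub (by simp) (by simp), integral_id]
    simp
    ring
  obtain ⟨r, s, hso, h1s, hr1, hrs, hrr, hrz⟩ := exists_smooth_sqrt (A := Y →L[ℝ] Y)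
  -- The substitution `y ↦ P y y` works if `P* J P = S`. With `P` the square root of `J S` near `1`,
  -- this reduces to `J P* J = P`.
  let X : Y → Y →L[ℝ] Y := fun y => J * S y
  have hX : ContDiff ℝ ∞ X := contDiff_const.mul hS
  have hX0 : X 0 = 1 := by simp only [X, hS0, hJ]
  let o := X ⁻¹' s
  have ho : IsOpen o := hso.preimage hX.continuous
  have h0o : (0 : Y) ∈ o := by simpa only [o, Set.mem_preimage, hX0] using h1s
  let P : Y → Y →L[ℝ] Y := fun y => r (X y)
  have hP : ContDiffOn ℝ ∞ P o := hrs.comp hX.contDiffOn fun y hy => hy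
  have hP0 : P 0 = 1 := by simp only [P, hX0, hr1]
  have hPd : DifferentiableAt ℝ P 0 :=
    (hP.contDiffAt (ho.mem_nhds h0o)).differentiableAt (by simp)
  -- `J P* J` is also a square root of `J S`, since `J` and `S` are self-adjoint, and near `1` the
  -- square root is unique.
  have hsym : ∀ᶠ y in nhds (0 : Y), J * star (P y) * J = P y := by
    have hcont : Filter.Tendsto (fun y => J * star (P y) * J) (nhds 0) (nhds 1) := by
      have h2 : ContinuousAt (fun y => J * star (P y) * J) 0 := by
        have := hPd.continuousAt
        fun_prop
      have := h2.tendsto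
      rwa [hP0, star_one, mul_one, hJ] at this
    filter_upwards [hcont.eventually hrz, ho.mem_nhds h0o] with y hy hyo
    rw [← hy]
    change r _ = r (X y)
    congr 1
    calc J * star (P y) * J * (J * star (P y) * J)
        = J * star (P y) * (J * J) * star (P y) * J := by noncomm_ring
      _ = J * star (P y * P y) * J := by rw [hJ, star_mul]; noncomm_ring
      _ = X y := by
        rw [show P y * P y = X y from hrr _ hyo]
        simp only [X, star_mul, hJs, hSsa]
        rw [← mul_assoc, mul_assoc _ J J, hJ, mul_one]
  obtain ⟨o', ho'sub, ho', h0o'⟩ := mem_nhds_iff.1 (Filter.inter_mem (ho.mem_nhds h0o) hsym)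
  have hd : HasFDerivAt (fun y => P y y) ((ContinuousLinearEquiv.refl ℝ Y : Y ≃L[ℝ] Y) : Y →L[ℝ] Y)
      0 := by
    have := hPd.hasFDerivAt.clm_apply (hasFDerivAt_id (𝕜 := ℝ) (0 : Y))
    refine this.congr_fderiv ?_
    ext x
    simp [hP0]
  have hsm : ContDiffOn ℝ ∞ (fun y => P y y) o' :=
    (hP.mono fun y hy => (ho'sub hy).1).clm_apply contDiffOn_id
  obtain ⟨e, he0, hes, he, hc, hcs⟩ := exists_smooth_chart ho' h0o' hsm _ hd
  refine ⟨e, he0, by simp [he], hc, hcs, fun y hy => ?_⟩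
  have hy' := ho'sub (hes hy)
  rw [taylor_two_of_critical hf h0 y, ← hSi, he]
  have h2 : star (P y) * J * P y = S y := by
    have h3 : J * star (P y) * J = P y := hy'.2
    have h4 : P y * P y = J * S y := hrr _ hy'.1
    calc star (P y) * J * P y = (J * J) * star (P y) * J * P y := by rw [hJ, one_mul]
      _ = J * (J * star (P y) * J) * P y := by noncomm_ring
      _ = (J * J) * S y := by rw [h3, mul_assoc, h4, mul_assoc]
      _ = S y := by rw [hJ, one_mul]
  have h5 : S y y = (P y).adjoint (J (P y y)) := by
    rw [← h2, ContinuousLinearMap.star_eq_adjoint]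
    rfl
  rw [h5, ContinuousLinearMap.adjoint_inner_left]

end MorseLemma

/-! ### Morse index of a pulled-back involution -/

section Involution

variable {Y : Type*} [NormedAddCommGroup Y] [InnerProductSpace ℝ Y]

lemma inner_eq_zero_of_eigen {J : Y →L[ℝ] Y} (hJs : ∀ x y, inner ℝ (J x) y = inner ℝ x (J y))
    {x y : Y} (hx : J x = -x) (hy : J y = y) : inner ℝ x y = 0 := by
  have := hJs x y
  rw [hx, hy, inner_neg_left] at this
  linarith

lemma inner_apply_self_add {J : Y →L[ℝ] Y} (hJs : ∀ x y, inner ℝ (J x) y = inner ℝ x (J y))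
    {x y : Y} (hx : J x = -x) (hy : J y = y) :
    inner ℝ (J (x + y)) (x + y) = -‖x‖ ^ 2 + ‖y‖ ^ 2 := by
  have h := inner_eq_zero_of_eigen hJs hx hy
  rw [map_add, hx, hy]
  simp only [inner_add_left, inner_add_right, inner_neg_left, real_inner_self_eq_norm_sq,
    real_inner_comm x y, h]
  ring

/-- The Morse index, when the second derivative is the pullback of the form of a self-adjoint
involution under a surjection. -/
lemma morseIndex_eq_of_involution {H : Type*} [NormedAddCommGroup H] [NormedSpace ℝ H]
    [FiniteDimensional ℝ Y] {f : H → ℝ} {x : H} (l : H →ₗ[ℝ] Y) (hl : Function.Surjective l)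
    {J : Y →L[ℝ] Y} (hJ : ∀ y, J (J y) = y)
    (hH : ∀ v, fderiv ℝ (fderiv ℝ f) x v v = 2 * inner ℝ (J (l v)) (l v)) :
    morseIndex f x =
      (Module.finrank ℝ (LinearMap.ker (J.toLinearMap + LinearMap.id)) : ℕ∞) := by
  set Y₁ := LinearMap.ker (J.toLinearMap + LinearMap.id) with hY₁
  have hmem : ∀ y, y ∈ Y₁ ↔ J y = -y := fun y => by
    rw [hY₁, LinearMap.mem_ker, LinearMap.add_apply, add_eq_zero_iff_eq_neg]
    rfl
  apply le_antisymm
  · refine iSup_le fun W => iSup_le fun hW => iSup_le fun hneg => ?_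
    rw [Nat.cast_le]
    -- Twice the projection of `l v` to the `-1` eigenspace. Its kernel consists of `v` with `J (l
    -- v) = l v`, where the form is nonnegative, so it is injective on a negative subspace.
    let p : W →ₗ[ℝ] Y₁ := LinearMap.codRestrict Y₁
      ((LinearMap.id - J.toLinearMap) ∘ₗ l ∘ₗ W.subtype) fun v => by
        rw [hmem]
        change J (l v - J (l v)) = -(l v - J (l v))
        rw [map_sub, hJ, neg_sub]
    refine LinearMap.finrank_le_finrank_of_injective (f := p) ?_
    rw [← LinearMap.ker_eq_bot, LinearMap.ker_eq_bot']
    intro v hv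
    have h1 : l v - J (l v) = 0 := congrArg Subtype.val hv
    by_contra hne
    have h2 := hneg v v.2 fun h => hne (Subtype.ext h)
    rw [hH, ← sub_eq_zero.1 h1] at h2
    have h3 : 0 ≤ inner ℝ (l v) (l v) := real_inner_self_nonneg
    linarith
  · obtain ⟨s, hs⟩ := l.exists_rightInverse_of_surjective (LinearMap.range_eq_top.2 hl)
    have hls : ∀ y, l (s y) = y := fun y => LinearMap.congr_fun hs y
    have hinj : Function.Injective s := fun a b h => by rw [← hls a, h, hls]
    have hfr : Module.finrank ℝ (Y₁.map s) = Module.finrank ℝ Y₁ :=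
      (Submodule.equivMapOfInjective s hinj Y₁).finrank_eq.symm
    rw [← hfr]
    refine le_iSup_of_le (Y₁.map s) (le_iSup_of_le inferInstance (le_iSup_of_le ?_ le_rfl))
    rintro _ ⟨y, hy, rfl⟩ hne
    rw [hH, hls, (hmem y).1 hy, inner_neg_left, real_inner_self_eq_norm_sq]
    have : y ≠ 0 := fun h => hne (by rw [h, map_zero])
    have := norm_pos_iff.2 this
    nlinarith

end Involution

/-! ### Constant rank and reduction to finite dimension -/

section Straightening

variable {H M Y : Type*} [NormedAddCommGroup H] [NormedSpace ℝ H] [NormedAddCommGroup M]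
  [NormedSpace ℝ M] [NormedAddCommGroup Y] [NormedSpace ℝ Y]

/-- If `L ∘ T` is onto and the range of `T` has the dimension of the codomain of `L`, then `L` is
injective on the range of `T`. -/
lemma eq_zero_of_finrank_range [FiniteDimensional ℝ Y] [FiniteDimensional ℝ M] (T : H →L[ℝ] M)
    (L : M →L[ℝ] Y)
    (hT : Module.finrank ℝ (LinearMap.range T.toLinearMap) = Module.finrank ℝ Y)
    (hs : ∀ y, ∃ v, L (T v) = y) {v : H} (hv : L (T v) = 0) : T v = 0 := by
  let q : LinearMap.range T.toLinearMap →ₗ[ℝ] Y :=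
    L.toLinearMap ∘ₗ (LinearMap.range T.toLinearMap).subtype
  have hq : Function.Surjective q := fun y => by
    obtain ⟨v, hv⟩ := hs y
    exact ⟨⟨T v, v, rfl⟩, hv⟩
  have hinj := (LinearMap.injective_iff_surjective_of_finrank_eq_finrank hT).2 hq
  have := @hinj ⟨T v, v, rfl⟩ 0 (by rw [map_zero]; exact hv)
  exact congrArg Subtype.val this

/-- **Constant rank.** A map of constant rank, read in a chart whose first component is a
coordinate of the map, does not depend on the second component. -/
lemma constant_rank_eq {K : Type*} [NormedAddCommGroup K] [NormedSpace ℝ K]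
    [FiniteDimensional ℝ Y] [FiniteDimensional ℝ M] {g : H → M} (hg : ContDiff ℝ ∞ g)
    (hrank : ∀ u, Module.finrank ℝ (LinearMap.range (fderiv ℝ g u).toLinearMap) =
      Module.finrank ℝ Y) (L : M →L[ℝ] Y) (m₀ : M) (e : OpenPartialHomeomorph H (Y × K))
    (he : ∀ u, (e u).1 = L (g u - m₀)) (hes : ContDiffOn ℝ ∞ e.symm e.target) {r : ℝ}
    (hr : Metric.ball (0 : Y) r ×ˢ Metric.ball (0 : K) r ⊆ e.target) {y : Y} {k : K}
    (hy : y ∈ Metric.ball (0 : Y) r) (hk : k ∈ Metric.ball (0 : K) r) :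
    g (e.symm (y, k)) = g (e.symm (y, 0)) := by
  have hd : ∀ q ∈ e.target, ∃ D : Y × K →L[ℝ] H, HasFDerivAt e.symm D q ∧
      ∀ κ : K, fderiv ℝ g (e.symm q) (D (0, κ)) = 0 := by
    intro q hq
    have hD := ((hes.contDiffAt (e.open_target.mem_nhds hq)).differentiableAt (by simp)).hasFDerivAt
    have hgd := (hg.differentiable (by simp) (e.symm q)).hasFDerivAt
    refine ⟨_, hD, fun κ => ?_⟩
    -- In the chart, `L` after the derivative of `g` is the first projection. It is onto, so by the
    -- rank hypothesis `L` is injective on the range of that derivative; directions `(0, κ)` are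
    -- then killed by the derivative itself.
    have hid : ∀ v : Y × K, L (fderiv ℝ g (e.symm q) (fderiv ℝ e.symm q v)) = v.1 := by
      have h1 : HasFDerivAt (fun p => L (g (e.symm p) - m₀))
          (L.comp ((fderiv ℝ g (e.symm q)).comp (fderiv ℝ e.symm q))) q :=
        L.hasFDerivAt.comp q ((hgd.comp q hD).sub_const m₀)
      have h2 : HasFDerivAt (fun p : Y × K => p.1) (ContinuousLinearMap.fst ℝ Y K) q :=
        hasFDerivAt_fst
      have h3 : (fun p => L (g (e.symm p) - m₀)) =ᶠ[nhds q] fun p : Y × K => p.1 := by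
        filter_upwards [e.open_target.mem_nhds hq] with p hp
        rw [← he, e.right_inv hp]
      have h4 := h1.unique (h2.congr_of_eventuallyEq h3)
      exact fun v => congrArg (fun A => A v) h4
    refine eq_zero_of_finrank_range _ L (hrank _) (fun y => ⟨_, hid (y, 0)⟩) ?_
    exact hid (0, κ)
  have h0 : (0 : K) ∈ Metric.ball (0 : K) r :=
    Metric.mem_ball_self (dist_nonneg.trans_lt (Metric.mem_ball.1 hk))
  have hline : ∀ k ∈ Metric.ball (0 : K) r,
      HasFDerivAt (fun k => g (e.symm (y, k))) (0 : K →L[ℝ] M) k := by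
    intro k hk
    obtain ⟨D, hD, hD0⟩ := hd (y, k) (hr ⟨hy, hk⟩)
    have h1 := (hg.differentiable (by simp) (e.symm (y, k))).hasFDerivAt.comp k
      (hD.comp k (hasFDerivAt_prodMk_right y k))
    refine h1.congr_fderiv ?_
    ext κ
    exact hD0 κ
  exact Metric.isOpen_ball.is_const_of_fderiv_eq_zero (convex_ball _ _).isPreconnected
    (fun k hk => (hline k hk).differentiableAt.differentiableWithinAt)
    (fun k hk => (hline k hk).fderiv) hk h0

/-- The second derivative of a composition at a critical point of the outer function. -/
lemma fderiv_fderiv_comp_of_critical {c : H → ℝ} (hc : ContDiff ℝ ∞ c) {s : Y → H} {o : Set Y}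
    (ho : IsOpen o) (h0 : (0 : Y) ∈ o) (hs : ContDiffOn ℝ ∞ s o) (hcrit : fderiv ℝ c (s 0) = 0)
    (x y : Y) : fderiv ℝ (fderiv ℝ fun y => c (s y)) 0 x y =
      fderiv ℝ (fderiv ℝ c) (s 0) (fderiv ℝ s 0 x) (fderiv ℝ s 0 y) := by
  have hsd : ∀ y ∈ o, HasFDerivAt s (fderiv ℝ s y) y := fun y hy =>
    ((hs.contDiffAt (ho.mem_nhds hy)).differentiableAt (by simp)).hasFDerivAt
  have h1 : fderiv ℝ (fun y => c (s y)) =ᶠ[nhds 0]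
      fun y => (fderiv ℝ c (s y)).comp (fderiv ℝ s y) := by
    filter_upwards [ho.mem_nhds h0] with y hy
    exact ((hc.differentiable (by simp) (s y)).hasFDerivAt.comp y (hsd y hy)).fderiv
  have h2 : HasFDerivAt (fun y => fderiv ℝ c (s y))
      ((fderiv ℝ (fderiv ℝ c) (s 0)).comp (fderiv ℝ s 0)) 0 :=
    (((hc.fderiv_right (m := ∞) (by simp)).differentiable (by simp)) (s 0)).hasFDerivAt.comp 0
      (hsd 0 h0)
  have h3 : DifferentiableAt ℝ (fderiv ℝ s) 0 :=
    ((hs.fderiv_of_isOpen (m := ∞) ho (by simp)).contDiffAt (ho.mem_nhds h0)).differentiableAt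
      (by simp)
  rw [h1.fderiv_eq, (h2.clm_comp h3.hasFDerivAt).fderiv]
  simp [hcrit]

/-- A function that is smooth near `0` agrees near `0` with a globally smooth function. -/
lemma exists_contDiff_eq_ball [HasContDiffBump Y] {f : Y → ℝ} {r : ℝ} (hr : 0 < r)
    (hf : ContDiffOn ℝ ∞ f (Metric.ball 0 r)) :
    ∃ F : Y → ℝ, ContDiff ℝ ∞ F ∧ ∃ δ, 0 < δ ∧ δ ≤ r ∧ ∀ y ∈ Metric.ball (0 : Y) δ, F y = f y := by
  let χ : ContDiffBump (0 : Y) := ⟨r / 3, r / 2, by positivity, by linarith⟩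
  refine ⟨fun y => χ y * f y, ?_, r / 3, by positivity, by linarith, fun y hy => ?_⟩
  · rw [contDiff_iff_contDiffAt]
    intro y
    by_cases hy : y ∈ Metric.ball (0 : Y) r
    · exact χ.contDiff.contDiffAt.mul (hf.contDiffAt (Metric.isOpen_ball.mem_nhds hy))
    · have h1 : ∀ᶠ z in nhds y, χ z * f z = 0 := by
        have h2 : y ∈ (Metric.closedBall (0 : Y) (r / 2))ᶜ := fun h => hy
          (Metric.closedBall_subset_ball (by linarith) h)
        filter_upwards [Metric.isClosed_closedBall.isOpen_compl.mem_nhds h2] with z hz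
        have : χ z = 0 := χ.zero_of_le_dist (by
          have : ¬ dist z 0 ≤ r / 2 := hz
          exact (not_le.1 this).le)
        rw [this, zero_mul]
      exact contDiffAt_const.congr_of_eventuallyEq h1
  · have : χ y = 1 := χ.one_of_mem_closedBall (Metric.ball_subset_closedBall hy)
    simp only [this, one_mul]

end Straightening

/-! ### The Morse–Bott chart -/

section MorseBott

variable {H M Y : Type*} [NormedAddCommGroup H] [InnerProductSpace ℝ H] [CompleteSpace H]
  [NormedAddCommGroup M] [NormedSpace ℝ M] [FiniteDimensional ℝ M]
  [NormedAddCommGroup Y] [InnerProductSpace ℝ Y] [FiniteDimensional ℝ Y]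

/-- The splitting `H ≃ Y × ker l` induced by a surjection `l : H → Y`. -/
lemma exists_splitting (l : H →L[ℝ] Y) (hl : Function.Surjective l) (K : Submodule ℝ H)
    [CompleteSpace K] (hK : ∀ v, v ∈ K ↔ l v = 0) :
    ∃ Φ : H ≃L[ℝ] Y × K, ∀ v, Φ v = (l v, K.orthogonalProjectionOnto v) := by
  let A : H →L[ℝ] Y × K := l.prod K.orthogonalProjectionOnto
  have hker : LinearMap.ker A.toLinearMap = ⊥ := by
    rw [LinearMap.ker_eq_bot']
    intro v hv
    have h1 : l v = 0 := congrArg Prod.fst hv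
    have h2 : K.orthogonalProjectionOnto v = 0 := congrArg Prod.snd hv
    have h3 := Submodule.orthogonalProjectionOnto_mem_subspace_eq_self (K := K) ⟨v, (hK v).2 h1⟩
    rw [h2] at h3
    exact (congrArg Subtype.val h3).symm
  have hrange : LinearMap.range A.toLinearMap = ⊤ := by
    rw [LinearMap.range_eq_top]
    rintro ⟨y, k⟩
    obtain ⟨v, rfl⟩ := hl y
    have hp : l (K.orthogonalProjectionOnto v) = 0 := (hK _).1 (K.orthogonalProjectionOnto v).2
    have hk : l k = 0 := (hK _).1 k.2
    refine ⟨v - K.orthogonalProjectionOnto v + k, Prod.ext ?_ ?_⟩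
    · change l _ = l v
      rw [map_add, map_sub, hp, hk, sub_zero, add_zero]
    · change K.orthogonalProjectionOnto _ = k
      rw [map_add, map_sub, Submodule.orthogonalProjectionOnto_mem_subspace_eq_self,
        Submodule.orthogonalProjectionOnto_mem_subspace_eq_self, sub_self, zero_add]
  exact ⟨ContinuousLinearEquiv.ofBijective A hker hrange, fun v => rfl⟩

/-- `Y × K ≃ H` for an isometry of `Y` onto the orthogonal complement of `K`. -/
lemma exists_isometric_assembly (l : H →L[ℝ] Y) (hl : Function.Surjective l) (K : Submodule ℝ H)
    [CompleteSpace K] (hK : ∀ v, v ∈ K ↔ l v = 0) :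
    ∃ (ι : Y →ₗᵢ[ℝ] H) (Λ : (Y × K) ≃L[ℝ] H), (∀ p, Λ p = ι p.1 + p.2) ∧ ∀ y, ι y ∈ Kᗮ := by
  let q : Kᗮ →ₗ[ℝ] Y := l.toLinearMap ∘ₗ Kᗮ.subtype
  have hq : Function.Bijective q := by
    constructor
    · rw [← LinearMap.ker_eq_bot, LinearMap.ker_eq_bot']
      intro v hv
      have h1 : (v : H) ∈ K := (hK v).2 hv
      have h2 := Submodule.inner_right_of_mem_orthogonal h1 v.2
      exact Subtype.ext (inner_self_eq_zero.1 h2)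
    · intro y
      obtain ⟨v, rfl⟩ := hl y
      have hp : l (K.orthogonalProjectionOnto v) = 0 := (hK _).1 (K.orthogonalProjectionOnto v).2
      refine ⟨⟨v - K.orthogonalProjectionOnto v, K.sub_starProjection_mem_orthogonal v⟩, ?_⟩
      change l (v - K.orthogonalProjectionOnto v) = l v
      rw [map_sub, hp, sub_zero]
  let qe := LinearEquiv.ofBijective q hq
  have : FiniteDimensional ℝ Kᗮ := qe.symm.finiteDimensional
  have hfr : Module.finrank ℝ Y = Module.finrank ℝ Kᗮ := qe.symm.finrank_eq
  -- The restriction of `l` to `Kᗮ` supplies only the equality of dimensions. An isometry is needed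
  -- instead, so that squared norms in `Y` become squared norms in `H`.
  let ι₀ : Y ≃ₗᵢ[ℝ] Kᗮ :=
    (stdOrthonormalBasis ℝ Y).equiv (stdOrthonormalBasis ℝ Kᗮ) (finCongr hfr)
  let ι : Y →ₗᵢ[ℝ] H := Kᗮ.subtypeₗᵢ.comp ι₀.toLinearIsometry
  have hι : ∀ y, ι y ∈ Kᗮ := fun y => (ι₀ y).2
  let A : (Y × K) →L[ℝ] H := ι.toContinuousLinearMap.coprod K.subtypeL
  have hker : LinearMap.ker A.toLinearMap = ⊥ := by
    rw [LinearMap.ker_eq_bot']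
    rintro ⟨y, k⟩ hv
    have h1 : ι y + (k : H) = 0 := hv
    have h2 := Submodule.inner_right_of_mem_orthogonal k.2 (hι y)
    have h3 : (k : H) = 0 := by
      rw [eq_neg_of_add_eq_zero_left h1, inner_neg_right, neg_eq_zero] at h2
      exact inner_self_eq_zero.1 h2
    rw [h3, add_zero] at h1
    have h4 : y = 0 := ι.injective (by rw [h1, map_zero])
    exact Prod.ext h4 (Subtype.ext h3)
  have hrange : LinearMap.range A.toLinearMap = ⊤ := by
    rw [LinearMap.range_eq_top]
    intro v
    refine ⟨(ι₀.symm ⟨v - K.orthogonalProjectionOnto v,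
      K.sub_starProjection_mem_orthogonal v⟩, K.orthogonalProjectionOnto v), ?_⟩
    change ((ι₀ (ι₀.symm _) : Kᗮ) : H) + K.orthogonalProjectionOnto v = v
    rw [LinearIsometryEquiv.apply_symm_apply]
    simp
  exact ⟨ι, ContinuousLinearEquiv.ofBijective A hker hrange, fun p => rfl, hι⟩

/-- **Morse–Bott lemma** for a linear function of a map of constant rank. -/
theorem morse_bott_chart {g : H → M} (hg : ContDiff ℝ ∞ g)
    (hrank : ∀ u, Module.finrank ℝ (LinearMap.range (fderiv ℝ g u).toLinearMap) =
      Module.finrank ℝ Y) (j : M →L[ℝ] ℝ) (L : M →L[ℝ] Y) (uc : H)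
    (hL : Function.Surjective fun v => L (fderiv ℝ g uc v)) (J : Y →L[ℝ] Y) (hJ : J * J = 1)
    (hJs : star J = J) (hcrit : fderiv ℝ (fun u => j (g u)) uc = 0)
    (hH : ∀ v, fderiv ℝ (fderiv ℝ fun u => j (g u)) uc v v =
      2 * inner ℝ (J (L (fderiv ℝ g uc v))) (L (fderiv ℝ g uc v))) :
    ∃ (P₁ P₂ K : Submodule ℝ H) (φ : OpenPartialHomeomorph H H),
      P₁ ⟂ P₂ ∧ P₁ ⟂ K ∧ P₂ ⟂ K ∧ P₁ ⊔ P₂ ⊔ K = ⊤ ∧ FiniteDimensional ℝ P₁ ∧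
      Module.finrank ℝ P₁ =
        Module.finrank ℝ (LinearMap.ker (J.toLinearMap + LinearMap.id)) ∧
      FiniteDimensional ℝ P₂ ∧ Module.finrank ℝ P₂ = Module.finrank ℝ Y -
        Module.finrank ℝ (LinearMap.ker (J.toLinearMap + LinearMap.id)) ∧
      uc ∈ φ.source ∧ ContDiffOn ℝ ∞ φ φ.source ∧ ContDiffOn ℝ ∞ φ.symm φ.target ∧
      φ uc = 0 ∧ φ '' (φ.source ∩ connectedComponentIn {u | g u = g uc} uc) = K ∧
      ∀ v₁ ∈ P₁, ∀ v₂ ∈ P₂, ∀ w ∈ K, v₁ + v₂ + w ∈ φ.target →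
        j (g (φ.symm (v₁ + v₂ + w))) = j (g uc) - ‖v₁‖ ^ 2 + ‖v₂‖ ^ 2 := by
  set T := fderiv ℝ g uc with hT
  let l : H →L[ℝ] Y := L.comp T
  have hl : Function.Surjective l := hL
  let K : Submodule ℝ H := LinearMap.ker l.toLinearMap
  have hK : ∀ v, v ∈ K ↔ l v = 0 := fun v => LinearMap.mem_ker
  have : CompleteSpace K := (l.isClosed_ker : IsClosed (K : Set H)).completeSpace_coe
  obtain ⟨Φ, hΦ⟩ := exists_splitting l hl K hK
  obtain ⟨ι, Λ, hΛ, hι⟩ := exists_isometric_assembly l hl K hK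
  have hJ' : ∀ y, J (J y) = y := fun y => congrArg (fun A => A y) hJ
  have hJin : ∀ x y, inner ℝ (J x) y = inner ℝ x (J y) := fun x y => by
    conv_rhs => rw [← hJs]
    rw [ContinuousLinearMap.star_eq_adjoint, ContinuousLinearMap.adjoint_inner_right]
  -- the chart that straightens the fibres of `g`
  let ψ : H → Y × K := fun u => (L (g u - g uc), K.orthogonalProjectionOnto (u - uc))
  have hψ : ContDiff ℝ ∞ ψ := (L.contDiff.comp (hg.sub contDiff_const)).prodMk
    (K.orthogonalProjectionOnto.contDiff.comp (contDiff_id.sub contDiff_const))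
  have hgd : HasFDerivAt g T uc := (hg.differentiable (by simp) uc).hasFDerivAt
  have hψd : HasFDerivAt ψ (Φ : H →L[ℝ] Y × K) uc := by
    have h1 := (L.hasFDerivAt.comp uc (hgd.sub_const (g uc))).prodMk
      (K.orthogonalProjectionOnto.hasFDerivAt.comp uc ((hasFDerivAt_id (𝕜 := ℝ) uc).sub_const uc))
    refine h1.congr_fderiv ?_
    ext v : 1
    exact (hΦ v).symm
  obtain ⟨e, hue, -, he, hec, hes⟩ := exists_smooth_chart isOpen_univ (Set.mem_univ uc)
    hψ.contDiffOn Φ hψd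
  have heuc : e uc = (0, 0) := by simp [he, ψ]
  have h0t : ((0 : Y), (0 : K)) ∈ e.target := heuc ▸ e.map_source hue
  have hes0 : e.symm (0, 0) = uc := by rw [← heuc, e.left_inv hue]
  obtain ⟨r, hr, hrt⟩ := Metric.isOpen_iff.1 e.open_target _ h0t
  rw [← ball_prod_same] at hrt
  have hconst : ∀ y ∈ Metric.ball (0 : Y) r, ∀ k ∈ Metric.ball (0 : K) r,
      g (e.symm (y, k)) = g (e.symm (y, 0)) := fun y hy k hk =>
    constant_rank_eq hg hrank L (g uc) e (fun u => by rw [he]) hes hrt hy hk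
  -- the reduced function
  let s : Y → H := fun y => e.symm (y, 0)
  have h0r : (0 : K) ∈ Metric.ball (0 : K) r := Metric.mem_ball_self hr
  have h0rY : (0 : Y) ∈ Metric.ball (0 : Y) r := Metric.mem_ball_self hr
  have hs : ContDiffOn ℝ ∞ s (Metric.ball 0 r) :=
    hes.comp (contDiff_id.prodMk contDiff_const).contDiffOn fun y hy => hrt ⟨hy, h0r⟩
  let c : H → ℝ := fun u => j (g u)
  have hc : ContDiff ℝ ∞ c := j.contDiff.comp hg
  have hf : ContDiffOn ℝ ∞ (fun y => c (s y)) (Metric.ball 0 r) := hc.comp_contDiffOn hs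
  -- The Morse lemma is stated for globally smooth functions, whereas the reduced function is smooth
  -- on a ball only.
  obtain ⟨F, hF, δ, hδ, hδr, hFf⟩ := exists_contDiff_eq_ball hr hf
  have hFe : F =ᶠ[nhds 0] fun y => c (s y) := by
    filter_upwards [Metric.ball_mem_nhds (0 : Y) hδ] with y hy using hFf y hy
  have hs0 : s 0 = uc := hes0
  have hsd : HasFDerivAt s (fderiv ℝ s 0) 0 :=
    ((hs.contDiffAt (Metric.ball_mem_nhds _ hr)).differentiableAt (by simp)).hasFDerivAt
  -- `s` is a section of `u ↦ L (g u - g uc)`, so pulling the Hessian of the cost back along `s`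
  -- returns the form of `J`.
  have hls : ∀ y, l (fderiv ℝ s 0 y) = y := by
    intro y
    have h1 : HasFDerivAt (fun y => L (g (s y) - g uc)) (l.comp (fderiv ℝ s 0)) 0 := by
      have hgd' : HasFDerivAt g T (s 0) := by rw [hs0]; exact hgd
      exact L.hasFDerivAt.comp 0 ((hgd'.comp 0 hsd).sub_const (g uc))
    have h2 : (fun y => L (g (s y) - g uc)) =ᶠ[nhds 0] fun y => y := by
      filter_upwards [Metric.ball_mem_nhds (0 : Y) hr] with y hy
      have h3 := e.right_inv (hrt ⟨hy, h0r⟩ : (y, (0 : K)) ∈ e.target)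
      rw [he] at h3
      exact congrArg Prod.fst h3
    exact congrArg (fun A => A y) (h1.unique ((hasFDerivAt_id (0 : Y)).congr_of_eventuallyEq h2))
  have hF0 : fderiv ℝ F 0 = 0 := by
    rw [hFe.fderiv_eq]
    have h1 : HasFDerivAt c (0 : H →L[ℝ] ℝ) (s 0) := by
      rw [hs0, ← hcrit]
      exact (hc.differentiable (by simp) uc).hasFDerivAt
    have h2 := (h1.comp 0 hsd).fderiv
    rw [ContinuousLinearMap.zero_comp] at h2
    exact h2
  have hFdiag : ∀ y, fderiv ℝ (fderiv ℝ F) 0 y y = 2 * inner ℝ (J y) y := by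
    intro y
    rw [hFe.fderiv.fderiv_eq, fderiv_fderiv_comp_of_critical hc Metric.isOpen_ball h0rY hs
      (by rw [hs0]; exact hcrit), hs0, hH]
    change 2 * inner ℝ (J (l _)) (l _) = _
    rw [hls]
  -- Polarization, using symmetry of the second derivative and of `J`.
  have hFH : ∀ x y, fderiv ℝ (fderiv ℝ F) 0 x y = 2 * inner ℝ (J x) y := by
    intro x y
    have hsym : fderiv ℝ (fderiv ℝ F) 0 x y = fderiv ℝ (fderiv ℝ F) 0 y x :=
      hF.contDiffAt.isSymmSndFDerivAt (by
        rw [minSmoothness_of_isRCLikeNormedField]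
        exact WithTop.coe_le_coe.2 (le_top : (2 : ℕ∞) ≤ ⊤)) x y
    have h1 := hFdiag (x + y)
    have h2 := hFdiag x
    have h3 := hFdiag y
    have h4 : inner ℝ (J y) x = inner ℝ (J x) y := by
      rw [hJin, real_inner_comm]
    simp only [map_add, add_apply, inner_add_left, inner_add_right, h4] at h1
    linarith
  obtain ⟨m, hm0, hm00, hmc, hms, hmF⟩ := morse_lemma hF hF0 J hJ hJs hFH
  let m' := m.restrOpen (Metric.ball 0 δ) Metric.isOpen_ball
  -- Stretches the ball of radius `r` in `K` onto all of `K`, so that the image of the component is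
  -- the whole of `K` and not just a ball in it.
  let b := (OpenPartialHomeomorph.univBall (0 : K) r).symm
  have hbs : b.source = Metric.ball (0 : K) r := OpenPartialHomeomorph.univBall_target 0 hr
  have hbt : b.target = Set.univ := OpenPartialHomeomorph.univBall_source 0 r
  have hb0 : b 0 = 0 := by
    have := OpenPartialHomeomorph.univBall_symm_apply_center (0 : K) r
    exact this
  let φ : OpenPartialHomeomorph H H :=
    (e.trans (m'.prod b)).trans Λ.toHomeomorph.toOpenPartialHomeomorph
  have hφa : ∀ u, φ u = Λ (m (e u).1, b (e u).2) := fun u => rfl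
  have hφs : ∀ u, u ∈ φ.source ↔ u ∈ e.source ∧ ((e u).1 ∈ m.source ∧ (e u).1 ∈ Metric.ball 0 δ) ∧
      (e u).2 ∈ Metric.ball (0 : K) r := by
    intro u
    rw [← hbs]
    simp only [φ, m', OpenPartialHomeomorph.trans_source, OpenPartialHomeomorph.prod_source,
      Set.mem_inter_iff, Set.mem_preimage, Set.mem_prod, OpenPartialHomeomorph.restrOpen_source,
      Homeomorph.toOpenPartialHomeomorph_source, Set.mem_univ, and_true]
  -- the reference curve through `uc` along the fibre
  let a : K → H := fun k => e.symm (0, b.symm k)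
  have hbk : ∀ k, b.symm k ∈ Metric.ball (0 : K) r := fun k =>
    hbs ▸ b.map_target (hbt ▸ Set.mem_univ k)
  have hat : ∀ k, ((0 : Y), b.symm k) ∈ e.target := fun k => hrt ⟨h0rY, hbk k⟩
  have hea : ∀ k, e (a k) = (0, b.symm k) := fun k => e.right_inv (hat k)
  have has : ∀ k, a k ∈ φ.source := fun k => by
    rw [hφs, hea]
    exact ⟨e.map_target (hat k), ⟨hm0, Metric.mem_ball_self hδ⟩, hbk k⟩
  have hφa0 : ∀ k, φ (a k) = k := fun k => by
    rw [hφa, hea, hΛ]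
    simp only [hm00, map_zero, zero_add]
    rw [b.right_inv (hbt ▸ Set.mem_univ k)]
  have hga : ∀ k, g (a k) = g uc := fun k => by
    rw [← hs0]
    exact hconst 0 h0rY _ (hbk k)
  have hb0' : b.symm 0 = 0 := by
    have := b.left_inv (hbs ▸ h0r : (0 : K) ∈ b.source)
    rwa [hb0] at this
  have ha0 : a 0 = uc := by
    simp only [a, hb0', hes0]
  have hac : Continuous a := by
    have h1 : Continuous b.symm := by
      rw [← continuousOn_univ, ← hbt]
      exact b.continuousOn_symm
    exact e.continuousOn_symm.comp_continuous (continuous_const.prodMk h1) hat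
  -- The local piece of the fibre is a continuous image of `K`, hence connected, and so lies in the
  -- component of `uc`.
  have hrange : Set.range a ⊆ connectedComponentIn {u | g u = g uc} uc :=
    (isPreconnected_range hac).subset_connectedComponentIn ⟨0, ha0⟩ (by
      rintro _ ⟨k, rfl⟩
      exact hga k)
  let Y₁ : Submodule ℝ Y := LinearMap.ker (J.toLinearMap + LinearMap.id)
  let Y₂ : Submodule ℝ Y := LinearMap.ker (J.toLinearMap - LinearMap.id)
  have hY₁ : ∀ y, y ∈ Y₁ ↔ J y = -y := fun y => by
    rw [LinearMap.mem_ker, LinearMap.add_apply, add_eq_zero_iff_eq_neg]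
    rfl
  have hY₂ : ∀ y, y ∈ Y₂ ↔ J y = y := fun y => by
    rw [LinearMap.mem_ker, LinearMap.sub_apply, sub_eq_zero]
    rfl
  have hsplit : ∀ y : Y, ∃ y₁ ∈ Y₁, ∃ y₂ ∈ Y₂, y₁ + y₂ = y := fun y => by
    refine ⟨(2⁻¹ : ℝ) • (y - J y), ?_, (2⁻¹ : ℝ) • (y + J y), ?_, ?_⟩
    · rw [hY₁, map_smul, map_sub, hJ', ← smul_neg, neg_sub]
    · rw [hY₂, map_smul, map_add, hJ', add_comm]
    · rw [← smul_add, sub_add_add_cancel, ← two_smul ℝ y, smul_smul]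
      norm_num
  have hcompl : IsCompl Y₁ Y₂ := by
    refine isCompl_iff.2 ⟨Submodule.disjoint_def.2 fun y h1 h2 => ?_, codisjoint_iff.2 ?_⟩
    · exact inner_self_eq_zero.1 (inner_eq_zero_of_eigen hJin ((hY₁ y).1 h1) ((hY₂ y).1 h2))
    · refine eq_top_iff.2 fun y _ => ?_
      obtain ⟨y₁, h1, y₂, h2, rfl⟩ := hsplit y
      exact Submodule.add_mem_sup h1 h2
  have hfr := Submodule.finrank_add_eq_of_isCompl hcompl
  have hfm : ∀ Z : Submodule ℝ Y, Module.finrank ℝ (Z.map ι.toLinearMap) = Module.finrank ℝ Z :=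
    fun Z => (Submodule.equivMapOfInjective ι.toLinearMap ι.injective Z).finrank_eq.symm
  refine ⟨Y₁.map ι.toLinearMap, Y₂.map ι.toLinearMap, K, φ, ?_, ?_, ?_, ?_, inferInstance, hfm Y₁,
    inferInstance, ?_, ?_, ?_, ?_, ?_, ?_, ?_⟩
  · rw [Submodule.isOrtho_iff_inner_eq]
    rintro _ ⟨y₁, h1, rfl⟩ _ ⟨y₂, h2, rfl⟩
    exact (ι.inner_map_map _ _).trans
      (inner_eq_zero_of_eigen hJin ((hY₁ _).1 h1) ((hY₂ _).1 h2))
  · rw [Submodule.isOrtho_iff_inner_eq]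
    rintro _ ⟨y, -, rfl⟩ k hk
    exact Submodule.inner_left_of_mem_orthogonal hk (hι y)
  · rw [Submodule.isOrtho_iff_inner_eq]
    rintro _ ⟨y, -, rfl⟩ k hk
    exact Submodule.inner_left_of_mem_orthogonal hk (hι y)
  · refine eq_top_iff.2 fun v _ => ?_
    obtain ⟨⟨y, k⟩, rfl⟩ := Λ.surjective v
    obtain ⟨y₁, h1, y₂, h2, rfl⟩ := hsplit y
    rw [hΛ, map_add]
    exact Submodule.add_mem_sup (Submodule.add_mem_sup ⟨y₁, h1, rfl⟩ ⟨y₂, h2, rfl⟩) k.2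
  · rw [hfm]
    exact (Nat.sub_eq_of_eq_add' hfr.symm).symm
  · rw [← ha0]
    exact has 0
  · have h1 : ContDiffOn ℝ ∞ (fun p : Y × K => (m p.1, b p.2))
        (m.source ×ˢ Metric.ball (0 : K) r) :=
      (hmc.comp contDiffOn_fst fun p hp => hp.1).prodMk
        ((OpenPartialHomeomorph.contDiffOn_univBall_symm (n := ⊤)).comp contDiffOn_snd
          fun p hp => hp.2)
    refine Λ.contDiff.comp_contDiffOn (h1.comp (hec.mono fun u hu => ((hφs u).1 hu).1) ?_)
    intro u hu
    have := (hφs u).1 hu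
    exact ⟨this.2.1.1, this.2.2⟩
  · have h1 : ∀ p ∈ φ.target, φ.symm p =
        e.symm (m.symm (Λ.symm p).1, b.symm (Λ.symm p).2) := fun p _ => rfl
    have h2 : ∀ p ∈ φ.target, (Λ.symm p).1 ∈ m.target ∧
        (m.symm (Λ.symm p).1, b.symm (Λ.symm p).2) ∈ e.target := by
      intro p hp
      have h3 := (hφs _).1 (φ.map_target hp)
      have h4 : Λ.symm p = (m (e (φ.symm p)).1, b (e (φ.symm p)).2) := by
        rw [← Λ.symm_apply_apply (m (e (φ.symm p)).1, b (e (φ.symm p)).2), ← hφa,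
          φ.right_inv hp]
      rw [h4]
      refine ⟨m.map_source h3.2.1.1, ?_⟩
      dsimp only
      rw [m.left_inv h3.2.1.1, b.left_inv (hbs ▸ h3.2.2)]
      exact e.map_source h3.1
    refine ContDiffOn.congr ?_ h1
    refine hes.comp ?_ fun p hp => (h2 p hp).2
    refine (hms.comp (contDiff_fst.comp Λ.symm.contDiff).contDiffOn fun p hp => (h2 p hp).1).prodMk ?_
    exact ((OpenPartialHomeomorph.contDiff_univBall (n := ⊤)).comp
      (contDiff_snd.comp Λ.symm.contDiff)).contDiffOn
  · have := hφa0 0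
    rw [ha0] at this
    exact this
  · apply Set.Subset.antisymm
    -- This inclusion needs only that the component lies in the fibre: there the `Y`-coordinate of
    -- the chart vanishes.
    · rintro _ ⟨u, ⟨hu, huC⟩, rfl⟩
      have hg0 : u ∈ {u | g u = g uc} := connectedComponentIn_subset _ _ huC
      have h1 : (e u).1 = 0 := by
        rw [he]
        simp [ψ, hg0.out]
      rw [hφa, h1, hm00, hΛ, map_zero, zero_add]
      exact Subtype.coe_prop _
    · intro k hk
      exact ⟨a ⟨k, hk⟩, ⟨has _, hrange ⟨_, rfl⟩⟩, hφa0 _⟩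
  · rintro _ ⟨y₁, h1, rfl⟩ _ ⟨y₂, h2, rfl⟩ w hw hp
    set u := φ.symm (ι.toLinearMap y₁ + ι.toLinearMap y₂ + w) with hu
    have h3 := (hφs _).1 (φ.map_target hp)
    rw [← hu] at h3
    have h4 : Λ (m (e u).1, b (e u).2) = Λ (y₁ + y₂, ⟨w, hw⟩) := by
      rw [← hφa, hu, φ.right_inv hp, hΛ, map_add]
      rfl
    have h5 : m (e u).1 = y₁ + y₂ := congrArg Prod.fst (Λ.injective h4)
    have h6 : g u = g (s (e u).1) := by
      conv_lhs => rw [← e.left_inv h3.1]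
      exact hconst _ (Metric.ball_subset_ball hδr h3.2.1.2) _ h3.2.2
    have h7 := hmF _ h3.2.1.1
    rw [hFf _ h3.2.1.2, hFf 0 (Metric.mem_ball_self hδ), h5,
      inner_apply_self_add hJin ((hY₁ _).1 h1) ((hY₂ _).1 h2), hs0] at h7
    have h8 : ‖ι.toLinearMap y₁‖ = ‖y₁‖ := ι.norm_map y₁
    have h9 : ‖ι.toLinearMap y₂‖ = ‖y₂‖ := ι.norm_map y₂
    rw [h6, h8, h9]
    refine h7.trans ?_
    change j (g uc) + _ = _
    ring

end MorseBott

/-! ### The control landscape near a critical fibre -/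

section Landscape

/-- Turns a signature with weights `±1` into a self-adjoint involution, the form in which the Morse
lemma takes it; the negative weights span the `-1` eigenspace. -/
lemma exists_diagonal_involution {N : ℕ} (w : Fin N → ℝ) (hw : ∀ i, w i = -1 ∨ w i = 1) :
    ∃ J : EuclideanSpace ℝ (Fin N) →L[ℝ] EuclideanSpace ℝ (Fin N), J * J = 1 ∧ star J = J ∧
      ∀ y, inner ℝ (J y) y = ∑ i, w i * y i ^ 2 := by
  let J₀ : EuclideanSpace ℝ (Fin N) →ₗ[ℝ] EuclideanSpace ℝ (Fin N) :=
    { toFun := fun y => WithLp.toLp 2 fun i => w i * y i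
      map_add' := fun x y => by ext i; simp [mul_add]
      map_smul' := fun c x => by ext i; simp [mul_left_comm] }
  have hJ₀ : ∀ y i, J₀ y i = w i * y i := fun y i => rfl
  refine ⟨J₀.toContinuousLinearMap, ?_, ?_, fun y => ?_⟩
  · ext y i
    change J₀ (J₀ y) i = y i
    rw [hJ₀, hJ₀]
    rcases hw i with h | h <;> simp [h]
  · rw [ContinuousLinearMap.star_eq_adjoint, ← ContinuousLinearMap.isSelfAdjoint_iff',
      ContinuousLinearMap.isSelfAdjoint_iff_isSymmetric]
    intro x y
    change inner ℝ (J₀ x) y = inner ℝ x (J₀ y)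
    simp only [PiLp.inner_apply, hJ₀, RCLike.inner_apply, conj_trivial]
    exact Finset.sum_congr rfl fun i _ => by ring
  · change inner ℝ (J₀ y) y = _
    simp only [PiLp.inner_apply, hJ₀, RCLike.inner_apply, conj_trivial]
    exact Finset.sum_congr rfl fun i _ => by ring

attribute [local instance] Matrix.linftyOpNormedRing Matrix.linftyOpNormedAlgebra

variable {n : ℕ}

/-- The kinematic cost as a bounded linear functional. -/
def kinematicCostCLM (θ : Matrix (Fin n) (Fin n) ℂ) : Matrix (Fin n) (Fin n) ℂ →L[ℝ] ℝ :=
  (Complex.reLm ∘ₗ (Matrix.traceLinearMap (Fin n) ℝ ℂ) ∘ₗ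
    (LinearMap.mulRight ℝ θ)).toContinuousLinearMap

lemma kinematicCostCLM_apply (θ A : Matrix (Fin n) (Fin n) ℂ) :
    kinematicCostCLM θ A = ((A * θ).trace).re := rfl

lemma contDiff_endPoint {T : ℝ} (hT : 0 ≤ T) (H₀ H₁ ρ₀ : Matrix (Fin n) (Fin n) ℂ) :
    ContDiff ℝ ∞ (endPoint T H₀ H₁ ρ₀) := by
  rw [endPoint_eq_commFlow hT]
  exact contDiff_commFlow hT H₀ H₁ ρ₀

/-- First and second variation of the cost at a control that steers to a critical point. -/
lemma cost_second_variation {T : ℝ} (hT : 0 ≤ T) {H₀ H₁ ρ₀ θ : Matrix (Fin n) (Fin n) ℂ}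
    (hH₀ : H₀ ∈ su n) (hH₁ : H₁ ∈ su n) {uc : Control T}
    (hθρ : Commute θ (endPoint T H₀ H₁ ρ₀ uc)) (v : Control T) :
    ∃ A : Matrix (Fin n) (Fin n) ℂ, Aᴴ = -A ∧
      fderiv ℝ (endPoint T H₀ H₁ ρ₀) uc v =
        A * endPoint T H₀ H₁ ρ₀ uc - endPoint T H₀ H₁ ρ₀ uc * A ∧
      fderiv ℝ (fderiv ℝ (cost T H₀ H₁ ρ₀ θ)) uc v v =
        ((A * (A * endPoint T H₀ H₁ ρ₀ uc - endPoint T H₀ H₁ ρ₀ uc * A) -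
          (A * endPoint T H₀ H₁ ρ₀ uc - endPoint T H₀ H₁ ρ₀ uc * A) * A) * θ).trace.re := by
  have : @ContinuousStar (Matrix (Fin n) (Fin n) ℂ)
      PseudoMetricSpace.toUniformSpace.toTopologicalSpace _ :=
    ⟨continuous_id.matrix_conjTranspose⟩
  have hU : ∀ u, propagator hT H₀ H₁ u * star (propagator hT H₀ H₁ u) = 1 :=
    fun u => propagator_mul_star hT hH₀.1 hH₁.1 u
  refine exists_second_variation (endPoint T H₀ H₁ ρ₀) (propagator hT H₀ H₁) ρ₀
    (contDiff_propagator hT H₀ H₁) (fun u => ?_) hU (fun u => mul_eq_one_comm.1 (hU u))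
    (kinematicCostCLM θ) uc v fun S _ => ?_
  · rw [endPoint_eq_commFlow hT]
    exact commFlow_eq_conj hT hH₀.1 hH₁.1 ρ₀ u
  · change ((S * endPoint T H₀ H₁ ρ₀ uc - endPoint T H₀ H₁ ρ₀ uc * S) * θ).trace.re = 0
    rw [trace_comm_mul_eq, trace_comm_mul_eq, hθρ.eq, sub_self, zero_mul, Matrix.trace_zero,
      Complex.zero_re]

/-- The local normal form of the cost, from a signature decomposition of its Hessian on the tangent
space of the orbit. -/
lemma landscape_chart {T : ℝ} (hT : 0 ≤ T) {H₀ H₁ ρ₀ θ : Matrix (Fin n) (Fin n) ℂ}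
    (hH₀ : H₀ ∈ su n) (hH₁ : H₁ ∈ su n) (hρ₀ : ρ₀.IsHermitian) (hθ : θ.IsHermitian)
    {uc : Control T} {ρ : Matrix (Fin n) (Fin n) ℂ} (hend : endPoint T H₀ H₁ ρ₀ uc = ρ)
    (hρc : IsKinematicCritical θ ρ₀ ρ)
    (hreg : ∀ u : Control T, IsRegularControl T H₀ H₁ ρ₀ u)
    (w : Fin (orbitDim ρ₀) → ℝ)
    (τ : tangentSpace ρ ≃ₗ[ℝ] (Fin (orbitDim ρ₀) → ℝ))
    (hτ : ∀ (A : Matrix (Fin n) (Fin n) ℂ) (hA : Aᴴ = -A),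
      ((A * (A * ρ - ρ * A) -
        (A * ρ - ρ * A) * A) * θ).trace.re =
          ∑ i, w i * (τ ⟨_, skew_comm_mem_tangentSpace hA _⟩ i) ^ 2)
    (J : EuclideanSpace ℝ (Fin (orbitDim ρ₀)) →L[ℝ] EuclideanSpace ℝ (Fin (orbitDim ρ₀)))
    (hJ : J * J = 1) (hJs : star J = J) (hJw : ∀ y, inner ℝ (J y) y = ∑ i, w i * y i ^ 2) :
    morseIndex (cost T H₀ H₁ ρ₀ θ) uc =
        (Module.finrank ℝ (LinearMap.ker (J.toLinearMap + LinearMap.id)) : ℕ∞) ∧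
    ∃ (P₁ P₂ K : Submodule ℝ (Control T))
      (φ : OpenPartialHomeomorph (Control T) (Control T)),
      P₁ ⟂ P₂ ∧ P₁ ⟂ K ∧ P₂ ⟂ K ∧ P₁ ⊔ P₂ ⊔ K = ⊤ ∧ FiniteDimensional ℝ P₁ ∧
      Module.finrank ℝ P₁ =
        Module.finrank ℝ (LinearMap.ker (J.toLinearMap + LinearMap.id)) ∧
      FiniteDimensional ℝ P₂ ∧ Module.finrank ℝ P₂ = orbitDim ρ₀ -
        Module.finrank ℝ (LinearMap.ker (J.toLinearMap + LinearMap.id)) ∧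
      uc ∈ φ.source ∧ ContDiffOn ℝ ∞ φ φ.source ∧ ContDiffOn ℝ ∞ φ.symm φ.target ∧
      φ uc = 0 ∧
      φ '' (φ.source ∩
        connectedComponentIn (fiber T H₀ H₁ ρ₀ ρ) uc) = K ∧
      ∀ v₁ ∈ P₁, ∀ v₂ ∈ P₂, ∀ k ∈ K, v₁ + v₂ + k ∈ φ.target →
        cost T H₀ H₁ ρ₀ θ (φ.symm (v₁ + v₂ + k)) =
          cost T H₀ H₁ ρ₀ θ uc - ‖v₁‖ ^ 2 + ‖v₂‖ ^ 2 := by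
  have hθρ := commute_of_isKinematicCritical hρ₀ hθ hρc
  have hvar := cost_second_variation hT hH₀ hH₁ (hend.symm ▸ hθρ)
  simp only [hend] at hvar
  have hfr : Module.finrank ℝ (EuclideanSpace ℝ (Fin (orbitDim ρ₀))) = orbitDim ρ₀ :=
    finrank_euclideanSpace_fin
  have h2 : √2 ≠ 0 := by positivity
  -- The factor `1/√2` absorbs the `2` in the normalization of the Hessian as `2 ⟪J y, y⟫`.
  let τ' : tangentSpace ρ →ₗ[ℝ] EuclideanSpace ℝ (Fin (orbitDim ρ₀)) :=
    (√2)⁻¹ • ((WithLp.linearEquiv 2 ℝ (Fin (orbitDim ρ₀) → ℝ)).symm.toLinearMap ∘ₗ τ.toLinearMap)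
  have hτ' : ∀ η i, τ' η i = (√2)⁻¹ * τ η i := fun η i => rfl
  -- The end-point map takes values in all matrices, so the coordinates on the tangent space are
  -- extended linearly to the ambient space.
  obtain ⟨L₀, hL₀⟩ := LinearMap.exists_extend τ'
  let L : Matrix (Fin n) (Fin n) ℂ →L[ℝ] EuclideanSpace ℝ (Fin (orbitDim ρ₀)) :=
    L₀.toContinuousLinearMap
  have hL : ∀ η : tangentSpace ρ, L η = τ' η := fun η => LinearMap.congr_fun hL₀ η
  let D : Control T →L[ℝ] Matrix (Fin n) (Fin n) ℂ := fderiv ℝ (endPoint T H₀ H₁ ρ₀) uc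
  -- The range consists of brackets `[A, ρ]`, hence of tangent vectors, and regularity gives it full
  -- dimension.
  have hrange : LinearMap.range D.toLinearMap = tangentSpace ρ := by
    refine Submodule.eq_of_le_of_finrank_eq ?_ ?_
    · rintro _ ⟨v, rfl⟩
      obtain ⟨A, hA, hAv, -⟩ := hvar v
      have : D v = A * ρ - ρ * A := hAv
      change D v ∈ _
      rw [this]
      exact skew_comm_mem_tangentSpace hA ρ
    · rw [finrank_tangentSpace_of_mem_orbit hρc.1]
      exact hreg uc
  have hsurj : Function.Surjective fun v => L (D v) := by
    intro y
    let η : tangentSpace ρ := τ.symm fun i => √2 * y i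
    have hη : (η : Matrix (Fin n) (Fin n) ℂ) ∈ LinearMap.range D.toLinearMap := by
      rw [hrange]
      exact η.2
    obtain ⟨v, hv⟩ := hη
    refine ⟨v, ?_⟩
    have hv' : D v = η := hv
    change L (D v) = y
    rw [hv', hL]
    ext i
    rw [hτ', LinearEquiv.apply_symm_apply, inv_mul_cancel_left₀ h2]
  have hH : ∀ v, fderiv ℝ (fderiv ℝ (cost T H₀ H₁ ρ₀ θ)) uc v v =
      2 * inner ℝ (J (L (D v))) (L (D v)) := by
    intro v
    obtain ⟨A, hA, hAv, hAH⟩ := hvar v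
    have hDv : D v = A * ρ - ρ * A := hAv
    have hLD : L (D v) = τ' ⟨_, skew_comm_mem_tangentSpace hA ρ⟩ := by
      rw [hDv, ← hL]
    rw [hAH, hτ A hA, hJw, hLD, Finset.mul_sum]
    refine Finset.sum_congr rfl fun i _ => ?_
    rw [hτ', mul_pow, inv_pow, Real.sq_sqrt zero_le_two]
    ring
  have hcrit : fderiv ℝ (cost T H₀ H₁ ρ₀ θ) uc = 0 := by
    have h1 : HasFDerivAt (cost T H₀ H₁ ρ₀ θ) ((kinematicCostCLM θ).comp D) uc :=
      (kinematicCostCLM θ).hasFDerivAt.comp uc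
        (((contDiff_endPoint hT H₀ H₁ ρ₀).differentiable (by simp) uc).hasFDerivAt)
    rw [h1.fderiv]
    ext v
    obtain ⟨A, hA, hAv, -⟩ := hvar v
    have hDv : D v = A * ρ - ρ * A := hAv
    change kinematicCostCLM θ (D v) = 0
    rw [hDv, kinematicCostCLM_apply, trace_comm_mul_eq, trace_comm_mul_eq, hθρ.eq, sub_self,
      zero_mul, Matrix.trace_zero, Complex.zero_re]
  refine ⟨morseIndex_eq_of_involution (L.comp D).toLinearMap hsurj
    (fun y => congrArg (fun A => A y) hJ) hH, ?_⟩
  have key := morse_bott_chart (contDiff_endPoint hT H₀ H₁ ρ₀)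
    (fun u => (hreg u).trans hfr.symm) (kinematicCostCLM θ) L uc hsurj J hJ hJs hcrit hH
  rw [hfr] at key
  subst hend
  exact key

end Landscape

end

end QuantumControl

theorem mainTheorem2 {n : ℕ} (T : ℝ) (hT : 0 < T)
    (H₀ H₁ ρ₀ θ : Matrix (Fin n) (Fin n) ℂ)
    (hH₀ : H₀ ∈ QuantumControl.su n) (hH₁ : H₁ ∈ QuantumControl.su n)
    (hρ₀ : ρ₀.IsHermitian) (hθ : θ.IsHermitian)
    (hρ₀_simple : Function.Injective hρ₀.eigenvalues)
    (hθ_simple : Function.Injective hθ.eigenvalues)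
    (hreg : ∀ u : QuantumControl.Control T, QuantumControl.IsRegularControl T H₀ H₁ ρ₀ u)
    (ρc : Matrix (Fin n) (Fin n) ℂ) (hρc : QuantumControl.IsKinematicCritical θ ρ₀ ρc) :
    -- `N₁` depends on the critical point `ρc` of `J` only
    ∃ N₁ : ℕ, N₁ ≤ QuantumControl.orbitDim ρ₀ ∧
      ∀ C : Set (QuantumControl.Control T),
        (∃ x ∈ QuantumControl.fiber T H₀ H₁ ρ₀ ρc,
          C = connectedComponentIn (QuantumControl.fiber T H₀ H₁ ρ₀ ρc) x) →
        ∀ uc ∈ C,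
          QuantumControl.morseIndex (QuantumControl.cost T H₀ H₁ ρ₀ θ) uc = (N₁ : ℕ∞) ∧
          ∃ (P₁ P₂ K : Submodule ℝ (QuantumControl.Control T))
            (φ : OpenPartialHomeomorph (QuantumControl.Control T) (QuantumControl.Control T)),
            -- the orthogonal decomposition of the control space
            P₁ ⟂ P₂ ∧ P₁ ⟂ K ∧ P₂ ⟂ K ∧ P₁ ⊔ P₂ ⊔ K = ⊤ ∧
            -- the dimensions of the two finite-dimensional summands
            FiniteDimensional ℝ P₁ ∧ Module.finrank ℝ P₁ = N₁ ∧
            FiniteDimensional ℝ P₂ ∧ Module.finrank ℝ P₂ = QuantumControl.orbitDim ρ₀ - N₁ ∧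
            -- `φ` is a smooth chart around `uc`
            uc ∈ φ.source ∧ ContDiffOn ℝ ∞ φ φ.source ∧ ContDiffOn ℝ ∞ φ.symm φ.target ∧
            -- it straightens the component `C`
            φ uc = 0 ∧ φ '' (φ.source ∩ C) = (K : Set (QuantumControl.Control T)) ∧
            -- the cost in the chart
            ∀ v₁ ∈ P₁, ∀ v₂ ∈ P₂, ∀ w ∈ K, v₁ + v₂ + w ∈ φ.target →
              QuantumControl.cost T H₀ H₁ ρ₀ θ (φ.symm (v₁ + v₂ + w)) =
                QuantumControl.cost T H₀ H₁ ρ₀ θ uc - ‖v₁‖ ^ 2 + ‖v₂‖ ^ 2 := by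
  -- The signature and the involution are fixed before any component or control is introduced, so
  -- the index depends on `ρc` only.
  obtain ⟨w, τ, hw, hτ⟩ := QuantumControl.exists_signature hρ₀ hθ hρ₀_simple hθ_simple hρc
  obtain ⟨J, hJ, hJs, hJw⟩ := QuantumControl.exists_diagonal_involution w hw
  have hfr : Module.finrank ℝ (EuclideanSpace ℝ (Fin (QuantumControl.orbitDim ρ₀))) =
      QuantumControl.orbitDim ρ₀ := finrank_euclideanSpace_fin
  refine ⟨Module.finrank ℝ (LinearMap.ker (J.toLinearMap + LinearMap.id)),
    (Submodule.finrank_le _).trans hfr.le, ?_⟩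
  rintro C ⟨x, -, rfl⟩ uc huc
  rw [connectedComponentIn_eq huc]
  have hend : uc ∈ QuantumControl.fiber T H₀ H₁ ρ₀ ρc := connectedComponentIn_subset _ _ huc
  exact QuantumControl.landscape_chart hT.le hH₀ hH₁ hρ₀ hθ hend hρc hreg w τ hτ J hJ hJs hJw
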